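/- For a complex matrix $Z$ let $r(Z)$ be its rank and $Z^*$ its conjugate transpose, and for a Hermitian $Z$ let $i_+(Z)$ and $i_-(Z)$ be the numbers of positive and of negative eigenvalues of $Z$, counted with multiplicity. Let $A\in\mathbb C^{n\times p}$ and $C\in\mathbb C^{n\times m}$, let $D\in\mathbb C^{n\times n}$ and $M\in\mathbb C^{m\times m}$ be Hermitian, and for $X\in\mathbb C^{p\times m}$ put $$\phi(X)=(AX+C)\,M\,(AX+C)^*+D .$$ Define the block matrices $$N_1=\begin{bmatrix} D+CMC^* & A\\ A^* & 0\end{bmatrix},\qquad N_2=\begin{bmatrix} D & CM & A\\ A^* & 0 & 0\end{bmatrix}.$$ Then the following maxima and minima over all $X\in\mathbb C^{p\times m}$ are attained and have the stated values (in the last two lines either all upper or all lower signs are taken): $$\max_{X} r[\phi(X)]=\min\{\,r[A,\,CM,\,D],\ r(N_1),\ r(M)+r(D)\,\},$$ $$\min_{X} r[\phi(X)]=2\,r[A,\,CM,\,D]+\max\{s_1,\,s_2,\,s_3,\,s_4\},$$ $$\max_{X} i_\pm[\phi(X)]=\min\{\,i_\pm(N_1),\ i_\pm(M)+i_\pm(D)\,\},$$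 $$\min_{X} i_\pm[\phi(X)]=r[A,\,CM,\,D]+\max\{\,i_\pm(N_1)-r(N_2),\ i_\pm(D)-r[A,\,D]-i_\mp(M)\,\},$$ where $$s_1=r(N_1)-2r(N_2),\qquad s_2=r(D)-2r[A,\,D]-r(M),$$ $$s_3=i_+(N_1)-r(N_2)+i_-(D)-r[A,\,D]-i_+(M),\qquad s_4=i_-(N_1)-r(N_2)+i_+(D)-r[A,\,D]-i_-(M).$$ -/

import Mathlib

open Matrix

namespace QuadInertia

noncomputable section

/-- The partial inertia `i₊(A)`: the number of positive eigenvalues of `A`, counted with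
multiplicity as roots of the characteristic polynomial. It is used only for Hermitian `A`,
whose eigenvalues are all real. -/
def posInertia {ι : Type*} [Fintype ι] [DecidableEq ι] (A : Matrix ι ι ℂ) : ℕ :=
  A.charpoly.roots.countP (fun z => 0 < z.re)

/-- The partial inertia `i₋(A)`: the number of negative eigenvalues of `A`, counted with
multiplicity as roots of the characteristic polynomial. It is used only for Hermitian `A`,
whose eigenvalues are all real. -/
def negInertia {ι : Type*} [Fintype ι] [DecidableEq ι] (A : Matrix ι ι ℂ) : ℕ :=
  A.charpoly.roots.countP (fun z => z.re < 0)

/-- On Hermitian matrices `posInertia` counts the positive eigenvalues. -/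
theorem posInertia_eq {ι : Type*} [Fintype ι] [DecidableEq ι] {A : Matrix ι ι ℂ}
    (hA : A.IsHermitian) :
    posInertia A = (Finset.univ.filter (fun i => 0 < hA.eigenvalues i)).card := by
  rw [posInertia, hA.roots_charpoly_eq_eigenvalues, Multiset.countP_map]
  simp [Finset.card_def]

/-- On Hermitian matrices `negInertia` counts the negative eigenvalues. -/
theorem negInertia_eq {ι : Type*} [Fintype ι] [DecidableEq ι] {A : Matrix ι ι ℂ}
    (hA : A.IsHermitian) :
    negInertia A = (Finset.univ.filter (fun i => hA.eigenvalues i < 0)).card := by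
  rw [negInertia, hA.roots_charpoly_eq_eigenvalues, Multiset.countP_map]
  simp [Finset.card_def]

/-- The quadratic matrix-valued function `φ(X) = (AX + C) M (AX + C)* + D`. -/
def phi {n p m : ℕ} (A : Matrix (Fin n) (Fin p) ℂ) (C : Matrix (Fin n) (Fin m) ℂ)
    (M : Matrix (Fin m) (Fin m) ℂ) (D : Matrix (Fin n) (Fin n) ℂ)
    (X : Matrix (Fin p) (Fin m) ℂ) : Matrix (Fin n) (Fin n) ℂ :=
  (A * X + C) * M * (A * X + C)ᴴ + D

/-- The Hermitian block matrix `N₁ = [[D + CMC*, A], [A*, 0]]`. -/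
def N₁ {n p m : ℕ} (A : Matrix (Fin n) (Fin p) ℂ) (C : Matrix (Fin n) (Fin m) ℂ)
    (M : Matrix (Fin m) (Fin m) ℂ) (D : Matrix (Fin n) (Fin n) ℂ) :
    Matrix (Fin n ⊕ Fin p) (Fin n ⊕ Fin p) ℂ :=
  fromBlocks (D + C * M * Cᴴ) A Aᴴ 0

/-- The block matrix `N₂ = [[D, CM, A], [A*, 0, 0]]`. -/
def N₂ {n p m : ℕ} (A : Matrix (Fin n) (Fin p) ℂ) (C : Matrix (Fin n) (Fin m) ℂ)
    (M : Matrix (Fin m) (Fin m) ℂ) (D : Matrix (Fin n) (Fin n) ℂ) :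
    Matrix (Fin n ⊕ Fin p) ((Fin n ⊕ Fin m) ⊕ Fin p) ℂ :=
  fromBlocks (fromCols D (C * M)) A (fromCols Aᴴ 0) 0

end

end QuadInertia

/-! Put `W = ℂⁿ × ℂᵐ` and `T = D ⊕ M`. Moving `AX + C` across the inner product, the Hermitian form
of `φ(X)` at `u` is the form of `T` at `(u, (AX + C)* u)`. So `i₊(φ(X))` is the positive index `idx
T V` of `T` on the graph `V` of `(AX + C)*`, and `i₋` is the same for `-T`. As `X` varies, `V` runs
over exactly those complements of `G = 0 × ℂᵐ` that contain `F = {(u, C* u) : A* u = 0}`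
(`exists_graphSpace_eq`). The inertia problem becomes one about subspaces.

Upper bounds: `idx T V` is at most `idx T ⊤`, and at most `idx T F` plus the codimension `r(A)` of
`F` in `V`. Adjoining suitable positive vectors to `F` attains the smaller one
(`exists_isCompl_idx_ge`). Lower bounds: one comes from the part of `F` orthogonal to `F ⊔ G`, the
other from the codimension of `V ⊔ ker T` in `W` (`idx_lower_bound_left`, `idx_lower_bound_right`).
A careful choice of adjoined vectors attains the larger one for `T` and for `-T` with the same `V`
(`exists_isCompl_idx_le`). Hence one `X` minimizes both inertias and therefore the rank, and the
four `sᵢ` come from adding two maxima.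

The dimensions involved are converted into ranks and inertias of the block matrices by
`posInertia_N₁`, `rank_N₂_add_finrank` and `finrank_vertSpace_inf`.

The maximal rank needs another argument, because both inertias need not be maximal at one `X`. The
two occurrences of `X` are made independent, generic ranks of affine matrix functions are applied
twice, and a polynomial in one parameter returns to a single `X` (`exists_rank_phi_ge`). -/

namespace QuadInertia

open Module Submodule

/-! ### Positive index and orthogonality for a Hermitian form on subspaces. -/

section Abstract

variable {W : Type*} [NormedAddCommGroup W] [InnerProductSpace ℂ W]

/-- The real quadratic form `x ↦ re ⟪T x, x⟫`. -/
noncomputable def quad (T : W →ₗ[ℂ] W) (x : W) : ℝ := (inner ℂ (T x) x).re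

/-- `T` is positive definite on the subspace `P`. -/
def PosOn (T : W →ₗ[ℂ] W) (P : Submodule ℂ W) : Prop := ∀ x ∈ P, x ≠ 0 → 0 < quad T x

/-- The largest dimension of a subspace of `S` on which `T` is positive definite. -/
noncomputable def idx (T : W →ₗ[ℂ] W) (S : Submodule ℂ W) : ℕ :=
  sSup {k | ∃ P ≤ S, PosOn T P ∧ finrank ℂ P = k}

/-- The orthogonal complement of `S` for the form `⟪T x, y⟫`. -/
noncomputable def orth (T : W →ₗ[ℂ] W) (S : Submodule ℂ W) : Submodule ℂ W := (S.map T)ᗮ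

theorem mem_orth {T : W →ₗ[ℂ] W} {S : Submodule ℂ W} {x : W} :
    x ∈ orth T S ↔ ∀ s ∈ S, inner ℂ (T s) x = 0 := by
  simp [orth, Submodule.mem_orthogonal]

theorem mem_orth' {T : W →ₗ[ℂ] W} (hT : T.IsSymmetric) {S : Submodule ℂ W} {x : W} :
    x ∈ orth T S ↔ ∀ s ∈ S, inner ℂ (T x) s = 0 := by
  rw [mem_orth]
  refine forall₂_congr fun s _ => ?_
  rw [hT, inner_eq_zero_symm]

theorem orth_anti (T : W →ₗ[ℂ] W) {S S' : Submodule ℂ W} (h : S ≤ S') : orth T S' ≤ orth T S :=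
  Submodule.orthogonal_le (Submodule.map_mono h)

theorem orth_sup (T : W →ₗ[ℂ] W) (S S' : Submodule ℂ W) :
    orth T (S ⊔ S') = orth T S ⊓ orth T S' := by
  rw [orth, Submodule.map_sup, ← Submodule.inf_orthogonal]; rfl

theorem orth_neg (T : W →ₗ[ℂ] W) (S : Submodule ℂ W) : orth (-T) S = orth T S := by
  ext x; simp [mem_orth]

theorem le_orth_comm {T : W →ₗ[ℂ] W} (hT : T.IsSymmetric) {S S' : Submodule ℂ W} :
    S ≤ orth T S' ↔ S' ≤ orth T S :=
  ⟨fun h x hx => mem_orth.2 fun _ hs => (mem_orth' hT).1 (h hs) x hx,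
    fun h x hx => mem_orth.2 fun _ hs => (mem_orth' hT).1 (h hs) x hx⟩

theorem ker_le_orth {T : W →ₗ[ℂ] W} (hT : T.IsSymmetric) (S : Submodule ℂ W) :
    LinearMap.ker T ≤ orth T S := fun x hx => (mem_orth' hT).2 fun s _ => by
  rw [LinearMap.mem_ker.1 hx, inner_zero_left]

theorem orth_top {T : W →ₗ[ℂ] W} (hT : T.IsSymmetric) : orth T ⊤ = LinearMap.ker T := by
  refine le_antisymm (fun x hx => ?_) (ker_le_orth hT _)
  exact inner_self_eq_zero.1 ((mem_orth' hT).1 hx (T x) trivial)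

theorem ker_neg (T : W →ₗ[ℂ] W) : LinearMap.ker (-T) = LinearMap.ker T := by
  ext x; simp

theorem isSymmetric_neg {T : W →ₗ[ℂ] W} (hT : T.IsSymmetric) : (-T).IsSymmetric := fun x y => by
  simpa using hT x y

@[simp] theorem quad_neg (T : W →ₗ[ℂ] W) (x : W) : quad (-T) x = -quad T x := by simp [quad]

@[simp] theorem quad_zero (T : W →ₗ[ℂ] W) : quad T 0 = 0 := by simp [quad]

theorem quad_eq_zero_of_mem_ker {T : W →ₗ[ℂ] W} {x : W} (hx : x ∈ LinearMap.ker T) :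
    quad T x = 0 := by
  simp [quad, LinearMap.mem_ker.1 hx]

theorem quad_add {T : W →ₗ[ℂ] W} (hT : T.IsSymmetric) (x y : W) :
    quad T (x + y) = quad T x + quad T y + 2 * (inner ℂ (T x) y).re := by
  have h : (inner ℂ (T y) x).re = (inner ℂ (T x) y).re := by
    rw [hT y x, ← inner_conj_symm, Complex.conj_re]
  simp only [quad, map_add, inner_add_left, inner_add_right, Complex.add_re, h]
  ring

theorem quad_add_of_orth {T : W →ₗ[ℂ] W} (hT : T.IsSymmetric) {x y : W}
    (h : inner ℂ (T x) y = 0) : quad T (x + y) = quad T x + quad T y := by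
  simp [quad_add hT, h]

theorem quad_smul (T : W →ₗ[ℂ] W) (c : ℂ) (x : W) :
    quad T (c • x) = ‖c‖ ^ 2 * quad T x := by
  simp only [quad, map_smul, inner_smul_left, inner_smul_right, ← mul_assoc]
  rw [mul_comm c, ← Complex.normSq_eq_conj_mul_self, Complex.re_ofReal_mul, Complex.normSq_eq_norm_sq]

theorem posOn_bot (T : W →ₗ[ℂ] W) : PosOn T ⊥ := fun _ hx h => absurd ((Submodule.mem_bot ℂ).1 hx) h

theorem PosOn.mono {T : W →ₗ[ℂ] W} {P P' : Submodule ℂ W} (h : PosOn T P') (hle : P ≤ P') :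
    PosOn T P := fun x hx => h x (hle hx)

theorem PosOn.nonneg {T : W →ₗ[ℂ] W} {P : Submodule ℂ W} (h : PosOn T P) {x : W} (hx : x ∈ P) :
    0 ≤ quad T x := by
  by_cases h0 : x = 0
  · simp [h0]
  · exact (h x hx h0).le

theorem posOn_span_singleton {T : W →ₗ[ℂ] W} {v : W} (hv : 0 < quad T v) :
    PosOn T (ℂ ∙ v) := by
  intro x hx h0
  obtain ⟨c, rfl⟩ := Submodule.mem_span_singleton.1 hx
  rw [quad_smul]
  have : c ≠ 0 := by rintro rfl; simp at h0
  positivity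

theorem PosOn.sup {T : W →ₗ[ℂ] W} (hT : T.IsSymmetric) {P P' : Submodule ℂ W} (h : PosOn T P)
    (h' : PosOn T P') (ho : P' ≤ orth T P) : PosOn T (P ⊔ P') := by
  intro x hx h0
  obtain ⟨y, hy, z, hz, rfl⟩ := Submodule.mem_sup.1 hx
  rw [quad_add_of_orth hT (mem_orth.1 (ho hz) y hy)]
  by_cases hy0 : y = 0
  · subst hy0; simp only [quad_zero, zero_add] at h0 ⊢
    exact h' z hz h0
  · exact add_pos_of_pos_of_nonneg (h y hy hy0) (h'.nonneg hz)

theorem PosOn.inf_eq_bot {T : W →ₗ[ℂ] W} {P K : Submodule ℂ W} (h : PosOn T P)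
    (hK : ∀ x ∈ K, quad T x ≤ 0) : P ⊓ K = ⊥ := by
  rw [eq_bot_iff]
  rintro x ⟨hx, hxK⟩
  by_contra h0
  exact absurd (h x hx h0) (not_lt.2 (hK x hxK))

theorem PosOn.inf_orth {T : W →ₗ[ℂ] W} {P : Submodule ℂ W} (h : PosOn T P) : P ⊓ orth T P = ⊥ := by
  rw [eq_bot_iff]
  rintro x ⟨hx, hxK⟩
  by_contra h0
  have := h x hx h0
  rw [quad, mem_orth.1 hxK x hx] at this
  simp at this

/-- A form of Cauchy–Schwarz: were `z` not orthogonal to some `y ∈ K`, the form at `t c z + y` would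
grow linearly in `t` and become positive. -/
theorem mem_orth_of_semidefinite {T : W →ₗ[ℂ] W} (hT : T.IsSymmetric) {K : Submodule ℂ W}
    (hK : ∀ x ∈ K, quad T x ≤ 0) {z : W} (hz : z ∈ K) (h0 : quad T z = 0) : z ∈ orth T K := by
  rw [mem_orth' hT]
  intro y hy
  by_contra hc
  set c := inner ℂ (T z) y with hcdef
  have hpos : 0 < ‖c‖ ^ 2 := by positivity
  have key : ∀ t : ℝ, quad T y + 2 * (t * ‖c‖ ^ 2) ≤ 0 := by
    intro t
    have h := hK (((t : ℂ) * c) • z + y) (K.add_mem (K.smul_mem _ hz) hy)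
    rw [quad_add hT, quad_smul, h0, map_smul, inner_smul_left, ← hcdef, map_mul, Complex.conj_ofReal,
      mul_assoc, ← Complex.normSq_eq_conj_mul_self, ← Complex.ofReal_mul, Complex.ofReal_re,
      Complex.normSq_eq_norm_sq] at h
    linarith
  have := key ((1 + |quad T y|) / ‖c‖ ^ 2)
  rw [div_mul_cancel₀ _ hpos.ne'] at this
  have := neg_abs_le (quad T y)
  have := abs_nonneg (quad T y)
  linarith

variable [FiniteDimensional ℂ W]

theorem finrank_add_le_of_inf_eq_bot {P K S : Submodule ℂ W} (h : P ⊓ K = ⊥) (hP : P ≤ S)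
    (hK : K ≤ S) : finrank ℂ P + finrank ℂ K ≤ finrank ℂ S := by
  have h1 := Submodule.finrank_sup_add_finrank_inf_eq P K
  rw [h, finrank_bot, add_zero] at h1
  rw [← h1]
  exact Submodule.finrank_mono (sup_le hP hK)

theorem bddAbove_idx (T : W →ₗ[ℂ] W) (S : Submodule ℂ W) :
    BddAbove {k | ∃ P ≤ S, PosOn T P ∧ finrank ℂ P = k} :=
  ⟨finrank ℂ W, by rintro k ⟨P, _, _, rfl⟩; exact Submodule.finrank_le P⟩

theorem le_idx {T : W →ₗ[ℂ] W} {S P : Submodule ℂ W} (hP : P ≤ S) (h : PosOn T P) :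
    finrank ℂ P ≤ idx T S := le_csSup (bddAbove_idx T S) ⟨P, hP, h, rfl⟩

theorem exists_idx (T : W →ₗ[ℂ] W) (S : Submodule ℂ W) :
    ∃ P ≤ S, PosOn T P ∧ finrank ℂ P = idx T S :=
  Nat.sSup_mem (s := {k | ∃ P ≤ S, PosOn T P ∧ finrank ℂ P = k})
    ⟨_, ⊥, bot_le, posOn_bot T, rfl⟩ (bddAbove_idx T S)

theorem idx_mono (T : W →ₗ[ℂ] W) {S S' : Submodule ℂ W} (h : S ≤ S') : idx T S ≤ idx T S' := by
  obtain ⟨P, hP, hpos, hr⟩ := exists_idx T S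
  exact hr ▸ le_idx (hP.trans h) hpos

theorem finrank_map_add_finrank_inf_ker {E : Type*} [AddCommGroup E] [Module ℂ E]
    (f : W →ₗ[ℂ] E) (S : Submodule ℂ W) :
    finrank ℂ (S.map f) + finrank ℂ (S ⊓ LinearMap.ker f : Submodule ℂ W) = finrank ℂ S := by
  have h := LinearMap.finrank_range_add_finrank_ker (f.domRestrict S)
  rwa [LinearMap.range_domRestrict, LinearMap.ker_domRestrict,
    ← Submodule.finrank_map_subtype_eq, Submodule.map_comap_subtype] at h

/-- `orth T S` is the ordinary complement of `T S`, whose dimension is that of `S` less that of `S ⊓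
ker T`. -/
theorem finrank_orth {T : W →ₗ[ℂ] W} (S : Submodule ℂ W) :
    finrank ℂ S + finrank ℂ (orth T S) =
      finrank ℂ W + finrank ℂ (S ⊓ LinearMap.ker T : Submodule ℂ W) := by
  have h1 := Submodule.finrank_add_finrank_orthogonal (S.map T)
  have h2 := finrank_map_add_finrank_inf_ker T S
  rw [orth]
  omega

theorem finrank_add_le (P K : Submodule ℂ W) :
    finrank ℂ P + finrank ℂ K ≤ finrank ℂ W + finrank ℂ (P ⊓ K : Submodule ℂ W) := by
  rw [← Submodule.finrank_sup_add_finrank_inf_eq P K]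
  exact Nat.add_le_add_right (Submodule.finrank_le _) _

theorem orth_orth {T : W →ₗ[ℂ] W} (hT : T.IsSymmetric) (S : Submodule ℂ W) :
    orth T (orth T S) = S ⊔ LinearMap.ker T := by
  symm
  apply Submodule.eq_of_le_of_finrank_eq
  · exact sup_le ((le_orth_comm hT).1 le_rfl) (ker_le_orth hT _)
  · have h1 := finrank_orth (T := T) S
    have h2 := finrank_orth (T := T) (orth T S)
    rw [inf_eq_right.2 (ker_le_orth hT S)] at h2
    have h3 := Submodule.finrank_sup_add_finrank_inf_eq S (LinearMap.ker T)
    omega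

/-- The form is nondegenerate on `P`, so `W` splits orthogonally along `P`. -/
theorem PosOn.sup_orth {T : W →ₗ[ℂ] W} {P : Submodule ℂ W} (h : PosOn T P) :
    P ⊔ orth T P = ⊤ := by
  apply Submodule.eq_top_of_finrank_eq
  have h1 := Submodule.finrank_sup_add_finrank_inf_eq P (orth T P)
  have h2 := finrank_orth (T := T) P
  have h3 : P ⊓ LinearMap.ker T = ⊥ := h.inf_eq_bot fun _ hx => (quad_eq_zero_of_mem_ker hx).le
  rw [h.inf_orth, finrank_bot] at h1
  rw [h3, finrank_bot] at h2
  omega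

theorem PosOn.sup_inf_orth {T : W →ₗ[ℂ] W} {P S : Submodule ℂ W} (h : PosOn T P) (hP : P ≤ S) :
    P ⊔ (S ⊓ orth T P) = S := by
  rw [inf_comm, ← sup_inf_assoc_of_le _ hP, h.sup_orth, top_inf_eq]

theorem PosOn.exists_sub_mem_orth {T : W →ₗ[ℂ] W} {P : Submodule ℂ W} (h : PosOn T P) (x : W) :
    ∃ p ∈ P, x - p ∈ orth T P := by
  have hx : x ∈ P ⊔ orth T P := by rw [h.sup_orth]; trivial
  obtain ⟨y, hy, z, hz, rfl⟩ := Submodule.mem_sup.1 hx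
  exact ⟨y, hy, by simpa using hz⟩

theorem finrank_sup_span_of_notMem {S : Submodule ℂ W} {v : W} (hv : v ∉ S) :
    finrank ℂ (S ⊔ (ℂ ∙ v) : Submodule ℂ W) = finrank ℂ S + 1 := by
  have h0 : v ≠ 0 := by rintro rfl; exact hv S.zero_mem
  have h1 := Submodule.finrank_sup_add_finrank_inf_eq S (ℂ ∙ v)
  have h2 : S ⊓ (ℂ ∙ v) = ⊥ := by
    rw [← disjoint_iff, disjoint_comm]
    exact (Submodule.disjoint_span_singleton' h0).2 hv |>.symm
  rw [h2, finrank_bot, finrank_span_singleton h0] at h1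
  omega

/-- A positive vector orthogonal to `P` could be adjoined to `P`, against maximality. -/
theorem quad_nonpos_of_maximal {T : W →ₗ[ℂ] W} (hT : T.IsSymmetric) {S P : Submodule ℂ W}
    (hP : P ≤ S) (h : PosOn T P) (hr : finrank ℂ P = idx T S) :
    ∀ x ∈ S ⊓ orth T P, quad T x ≤ 0 := by
  rintro x ⟨hx, hxo⟩
  by_contra hq
  rw [not_le] at hq
  have hxP : x ∉ P := fun hxP => by
    have : x ∈ P ⊓ orth T P := ⟨hxP, hxo⟩
    rw [h.inf_orth, Submodule.mem_bot] at this
    simp [this] at hq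
  have hpos := h.sup hT (posOn_span_singleton hq)
    ((Submodule.span_singleton_le_iff_mem _ _).2 hxo)
  have := le_idx (sup_le hP ((Submodule.span_singleton_le_iff_mem _ _).2 hx)) hpos
  rw [finrank_sup_span_of_notMem hxP] at this
  omega

/-- A positive subspace meets the nonpositive `K` trivially, so its dimension is at most the
codimension of `K` in `A ⊔ K`. -/
theorem idx_le_of_le_sup {T : W →ₗ[ℂ] W} {S A K : Submodule ℂ W}
    (hK : ∀ x ∈ K, quad T x ≤ 0) (hS : S ≤ A ⊔ K) : idx T S ≤ finrank ℂ A := by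
  obtain ⟨P, hP, hpos, hr⟩ := exists_idx T S
  have h1 := finrank_add_le_of_inf_eq_bot (hpos.inf_eq_bot hK) (hP.trans hS) le_sup_right
  have h2 := Submodule.finrank_add_le_finrank_add_finrank A K
  omega

/-- Intersecting a maximal positive subspace of `V` with `F` loses at most the codimension of `F`.
-/
theorem idx_add_finrank_le (T : W →ₗ[ℂ] W) {F V : Submodule ℂ W} (h : F ≤ V) :
    idx T V + finrank ℂ F ≤ idx T F + finrank ℂ V := by
  obtain ⟨P, hP, hpos, hr⟩ := exists_idx T V
  have h1 := Submodule.finrank_sup_add_finrank_inf_eq P F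
  have h2 := Submodule.finrank_mono (sup_le hP h)
  have h3 := le_idx (inf_le_right : P ⊓ F ≤ F) (hpos.mono inf_le_left)
  omega

theorem idx_sup_le_of_nonpos {T : W →ₗ[ℂ] W} (hT : T.IsSymmetric) {F R : Submodule ℂ W}
    (hR : R ≤ orth T F) (hq : ∀ x ∈ R, quad T x ≤ 0) : idx T (F ⊔ R) ≤ idx T F := by
  obtain ⟨P, hP, hpos, hr⟩ := exists_idx T F
  rw [← hr]
  apply idx_le_of_le_sup (K := F ⊓ orth T P ⊔ R)
  · intro x hx
    obtain ⟨y, hy, z, hz, rfl⟩ := Submodule.mem_sup.1 hx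
    rw [quad_add_of_orth hT (mem_orth.1 (hR hz) y hy.1)]
    exact add_nonpos (quad_nonpos_of_maximal hT hP hpos hr y hy) (hq z hz)
  · rw [← sup_assoc, hpos.sup_inf_orth hP]

theorem idx_sup_span_le {T : W →ₗ[ℂ] W} (hT : T.IsSymmetric) {F : Submodule ℂ W} {w : W}
    (hw : w ∈ orth T F) (hq : quad T w ≤ 0) : idx T (F ⊔ (ℂ ∙ w)) ≤ idx T F := by
  refine idx_sup_le_of_nonpos hT ((Submodule.span_singleton_le_iff_mem _ _).2 hw) fun x hx => ?_
  obtain ⟨c, rfl⟩ := Submodule.mem_span_singleton.1 hx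
  rw [quad_smul]
  exact mul_nonpos_of_nonneg_of_nonpos (by positivity) hq

/-- Sylvester's law of inertia for the restriction of a Hermitian form to a subspace. -/
theorem finrank_eq_idx_add_idx {T : W →ₗ[ℂ] W} (hT : T.IsSymmetric) (F : Submodule ℂ W) :
    idx T F + idx (-T) F + finrank ℂ (F ⊓ orth T F : Submodule ℂ W) = finrank ℂ F := by
  apply le_antisymm
  -- The form is nonnegative on `P` plus the radical, so this sum meets the negative subspace `Q`
  -- trivially.
  · obtain ⟨P, hP, hpos, hr⟩ := exists_idx T F
    obtain ⟨Q, hQ, hneg, hr'⟩ := exists_idx (-T) F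
    have hR0 : ∀ x ∈ F ⊓ orth T F, quad T x = 0 := fun x hx => by
      rw [quad, mem_orth.1 hx.2 x hx.1, Complex.zero_re]
    have h1 := finrank_add_le_of_inf_eq_bot (hpos.inf_eq_bot fun x hx => (hR0 x hx).le)
      (le_sup_left : P ≤ P ⊔ (F ⊓ orth T F)) le_sup_right
    have h2 : Q ⊓ (P ⊔ (F ⊓ orth T F)) = ⊥ := hneg.inf_eq_bot fun x hx => by
      obtain ⟨y, hy, z, hz, rfl⟩ := Submodule.mem_sup.1 hx
      rw [quad_neg, quad_add_of_orth hT (mem_orth.1 hz.2 y (hP hy)), hR0 z hz, add_zero]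
      exact neg_nonpos.2 (hpos.nonneg hy)
    have h3 := finrank_add_le_of_inf_eq_bot h2 hQ (sup_le hP inf_le_left)
    omega
  -- Split off a maximal negative `Q`, then a maximal positive `P` in the rest. The form vanishes on
  -- what remains, and semidefiniteness puts the remainder in the radical.
  · obtain ⟨Q, hQ, hneg, hr'⟩ := exists_idx (-T) F
    have hF1 := quad_nonpos_of_maximal (isSymmetric_neg hT) hQ hneg hr'
    have hQF := hneg.sup_inf_orth hQ
    rw [orth_neg] at hF1 hQF
    obtain ⟨P, hP, hpos, hr⟩ := exists_idx T (F ⊓ orth T Q)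
    have hR := quad_nonpos_of_maximal hT hP hpos hr
    have hPF := hpos.sup_inf_orth hP
    have hle : (F ⊓ orth T Q) ⊓ orth T P ≤ F ⊓ orth T F := by
      intro x hx
      refine ⟨hx.1.1, ?_⟩
      rw [← hQF, orth_sup]
      refine ⟨hx.1.2, ?_⟩
      rw [← orth_neg]
      refine mem_orth_of_semidefinite (isSymmetric_neg hT) hF1 hx.1 ?_
      have h1 := hF1 x hx.1
      have h2 := hR x hx
      rw [quad_neg] at h1 ⊢
      linarith
    have h1 := Submodule.finrank_mono hle
    have h2 := Submodule.finrank_add_le_finrank_add_finrank Q (F ⊓ orth T Q)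
    have h3 := Submodule.finrank_add_le_finrank_add_finrank P ((F ⊓ orth T Q) ⊓ orth T P)
    have h4 := idx_mono T (inf_le_left : F ⊓ orth T Q ≤ F)
    rw [hQF] at h2
    rw [hPF] at h3
    omega

/-- Let `Q` be maximal negative in `F`. By dimension count a maximal positive subspace of `W` meets
the orthogonal of `F ⊓ orth T Q`. Removing the `Q`-component of a common vector makes it orthogonal
to `F` and does not decrease its form. -/
theorem exists_pos_mem_orth {T : W →ₗ[ℂ] W} (hT : T.IsSymmetric) {F : Submodule ℂ W}
    (hN : LinearMap.ker T ≤ F)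
    (h : finrank ℂ F < idx T ⊤ + idx (-T) F + finrank ℂ (LinearMap.ker T)) :
    ∃ v ∈ orth T F, 0 < quad T v := by
  obtain ⟨Q, hQ, hneg, hr'⟩ := exists_idx (-T) F
  obtain ⟨P, -, hpos, hr⟩ := exists_idx T ⊤
  have hQF := hneg.sup_inf_orth hQ
  rw [orth_neg] at hQF
  have h1 := finrank_add_le_of_inf_eq_bot (S := F) (P := Q) (K := F ⊓ orth T Q)
    (by rw [← orth_neg, ← inf_assoc, inf_eq_left.2 hQ, hneg.inf_orth]) hQ inf_le_left
  have h2 := finrank_orth (T := T) (F ⊓ orth T Q)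
  rw [inf_eq_right.2 (le_inf hN (ker_le_orth hT Q))] at h2
  have h3 := finrank_add_le P (orth T (F ⊓ orth T Q))
  have h4 : 0 < finrank ℂ (P ⊓ orth T (F ⊓ orth T Q) : Submodule ℂ W) := by omega
  have h5 : P ⊓ orth T (F ⊓ orth T Q) ≠ ⊥ := by
    intro h; rw [h, finrank_bot] at h4; exact lt_irrefl _ h4
  obtain ⟨v, hv, hv0⟩ := Submodule.exists_mem_ne_zero_of_ne_bot h5
  obtain ⟨p, hp, hpo⟩ := hneg.exists_sub_mem_orth v
  refine ⟨v - p, ?_, ?_⟩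
  · rw [← hQF, orth_sup]
    refine ⟨by rwa [← orth_neg T Q], Submodule.sub_mem _ hv.2 ?_⟩
    refine (le_orth_comm hT).1 ?_ hp
    exact inf_le_right
  · have h6 : quad T v = quad T p + quad T (v - p) := by
      rw [← quad_add_of_orth hT]
      · simp
      · rw [orth_neg] at hpo; exact mem_orth.1 hpo p hp
    have h7 := hneg.nonneg hp
    rw [quad_neg] at h7
    have := hpos v hv.1 hv0
    linarith

end Abstract

end QuadInertia

namespace QuadInertia

open Module Submodule

/-! ### Extremal indices among the complements of `G` that contain `F`. -/

section Extremal

variable {W : Type*} [NormedAddCommGroup W] [InnerProductSpace ℂ W]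

theorem exists_pos_add_smul {T : W →ₗ[ℂ] W} (hT : T.IsSymmetric) {v : W} (hv : 0 < quad T v)
    (u : W) : ∃ ε > 0, ∀ t : ℝ, 0 < t → t < ε → 0 < quad T (v + (t : ℂ) • u) := by
  have hc : Continuous fun t : ℝ => quad T (v + (t : ℂ) • u) := by
    have h : (fun t : ℝ => quad T (v + (t : ℂ) • u)) =
        fun t : ℝ => quad T v + t ^ 2 * quad T u + 2 * (t * (inner ℂ (T v) u).re) := by
      funext t
      rw [quad_add hT, quad_smul, inner_smul_right, Complex.re_ofReal_mul, Complex.norm_real,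
        Real.norm_eq_abs, sq_abs]
    rw [h]
    fun_prop
  have h0 : 0 < quad T (v + ((0 : ℝ) : ℂ) • u) := by simpa using hv
  obtain ⟨ε, hε, h⟩ := Metric.eventually_nhds_iff.1 (hc.continuousAt.eventually (lt_mem_nhds h0))
  refine ⟨ε, hε, fun t ht ht' => h ?_⟩
  rw [Real.dist_eq, sub_zero, abs_of_pos ht]
  exact ht'

/-- A subspace missing `e` contains `e + ζ f` for at most one `ζ`; the three unit scalars `1, -1, i`
outnumber the two subspaces. -/
theorem exists_norm_one_add_smul_notMem {S₁ S₂ : Submodule ℂ W} {e : W} (h₁ : e ∉ S₁)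
    (h₂ : e ∉ S₂) (f : W) : ∃ ζ : ℂ, ‖ζ‖ = 1 ∧ e + ζ • f ∉ S₁ ∧ e + ζ • f ∉ S₂ := by
  have key : ∀ S : Submodule ℂ W, e ∉ S → ∀ ζ ξ : ℂ, e + ζ • f ∈ S → e + ξ • f ∈ S → ζ = ξ := by
    intro S he ζ ξ h h'
    by_contra hne
    have h3 := S.sub_mem h h'
    have h4 : (ζ - ξ) • f ∈ S := by convert h3 using 1; module
    rw [S.smul_mem_iff (sub_ne_zero.2 hne)] at h4
    exact he ((S.add_mem_iff_left (S.smul_mem _ h4)).1 h)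
  by_contra! hcon
  have e1 : (1 : ℂ) ≠ -1 := by norm_num
  have e2 : (1 : ℂ) ≠ Complex.I := by intro h; simpa using congrArg Complex.re h
  have e3 : (-1 : ℂ) ≠ Complex.I := by intro h; simpa using congrArg Complex.re h
  have a := hcon 1 (by simp)
  have b := hcon (-1) (by simp)
  have c := hcon Complex.I (by simp)
  by_cases ha : e + (1 : ℂ) • f ∈ S₁ <;> by_cases hb : e + (-1 : ℂ) • f ∈ S₁ <;>
    by_cases hc : e + Complex.I • f ∈ S₁
  · exact e1 (key _ h₁ _ _ ha hb)
  · exact e1 (key _ h₁ _ _ ha hb)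
  · exact e2 (key _ h₁ _ _ ha hc)
  · exact e3 (key _ h₂ _ _ (b hb) (c hc))
  · exact e3 (key _ h₁ _ _ hb hc)
  · exact e2 (key _ h₂ _ _ (a ha) (c hc))
  · exact e1 (key _ h₂ _ _ (a ha) (b hb))
  · exact e1 (key _ h₂ _ _ (a ha) (b hb))

theorem exists_isCompl_ge {F G V : Submodule ℂ W} (hFV : F ≤ V) (hFG : Disjoint F G)
    (hVG : V ⊔ G = ⊤) : ∃ V' ≤ V, F ≤ V' ∧ IsCompl V' G := by
  -- Taking `S` complementary to `F ⊔ V ⊓ G`, the space `F ⊔ S ⊓ V` discards just the `V ⊓ G` part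
  -- of `V`.
  obtain ⟨S, hS⟩ := Submodule.exists_isCompl (F ⊔ V ⊓ G)
  have hV : (F ⊔ V ⊓ G) ⊔ S ⊓ V = V := by
    rw [← sup_inf_assoc_of_le _ (sup_le hFV inf_le_left), hS.sup_eq_top, top_inf_eq]
  refine ⟨F ⊔ S ⊓ V, sup_le hFV inf_le_right, le_sup_left, ?_, ?_⟩
  · rw [Submodule.disjoint_def]
    intro x hx hxG
    obtain ⟨f, hf, s, hs, rfl⟩ := Submodule.mem_sup.1 hx
    have h1 : s ∈ F ⊔ V ⊓ G := by
      have h2 : f + s ∈ F ⊔ V ⊓ G :=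
        (le_sup_right : V ⊓ G ≤ _) ⟨V.add_mem (hFV hf) hs.2, hxG⟩
      exact (Submodule.add_mem_iff_right _ ((le_sup_left : F ≤ _) hf)).1 h2
    have h3 := Submodule.disjoint_def.1 hS.disjoint s h1 hs.1
    subst h3
    rw [add_zero] at hxG ⊢
    exact Submodule.disjoint_def.1 hFG f hf hxG
  · rw [codisjoint_iff, eq_top_iff, ← hVG]
    refine sup_le ?_ le_sup_right
    conv_lhs => rw [← hV]
    exact sup_le (sup_le (le_sup_left.trans le_sup_left) (inf_le_right.trans le_sup_right))
      (le_sup_right.trans le_sup_left)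

theorem disjoint_sup_span {F G : Submodule ℂ W} (hFG : Disjoint F G) {w : W} (hw : w ∉ F ⊔ G) :
    Disjoint (F ⊔ (ℂ ∙ w)) G := by
  rw [Submodule.disjoint_def]
  intro x hx hxG
  obtain ⟨f, hf, y, hy, rfl⟩ := Submodule.mem_sup.1 hx
  obtain ⟨c, rfl⟩ := Submodule.mem_span_singleton.1 hy
  by_cases hc : c = 0
  · subst hc
    rw [zero_smul, add_zero] at hxG ⊢
    exact Submodule.disjoint_def.1 hFG f hf hxG
  · refine absurd ?_ hw
    have h1 : f + c • w ∈ F ⊔ G := (le_sup_right : G ≤ _) hxG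
    rwa [Submodule.add_mem_iff_right _ ((le_sup_left : F ≤ _) hf),
      Submodule.smul_mem_iff _ hc] at h1

/-- A positive vector in `K` can be moved within `K` out of a subspace not containing `K`, without
entering another given subspace to which it does not belong. -/
theorem exists_pos_notMem {T : W →ₗ[ℂ] W} (hT : T.IsSymmetric) {K S₁ S₂ : Submodule ℂ W} {v : W}
    (hvK : v ∈ K) (hv : 0 < quad T v) (hv₁ : v ∉ S₁) (hS₂ : ¬ K ≤ S₂) :
    ∃ w ∈ K, 0 < quad T w ∧ w ∉ S₁ ∧ w ∉ S₂ := by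
  by_cases hv₂ : v ∈ S₂
  swap
  · exact ⟨v, hvK, hv, hv₁, hv₂⟩
  obtain ⟨u, huK, hu⟩ := SetLike.not_le_iff_exists.1 hS₂
  obtain ⟨ε, hε, h⟩ := exists_pos_add_smul hT hv u
  have hmem : ∀ t : ℝ, 0 < t → v + (t : ℂ) • u ∉ S₂ := by
    intro t ht hmem
    rw [S₂.add_mem_iff_right hv₂, S₂.smul_mem_iff (by exact_mod_cast ht.ne')] at hmem
    exact hu hmem
  -- The line `v + t u` meets `S₁` at most once since `v ∉ S₁`, so `t = ε / 2` or `t = ε / 3` works;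
  -- indeed `3 (v + (ε/3) u) - 2 (v + (ε/2) u) = v`.
  by_cases h1 : v + ((ε / 2 : ℝ) : ℂ) • u ∈ S₁
  · refine ⟨v + ((ε / 3 : ℝ) : ℂ) • u, K.add_mem hvK (K.smul_mem _ huK),
      h _ (by positivity) (by linarith), fun h2 => hv₁ ?_, hmem _ (by positivity)⟩
    have h3 := S₁.sub_mem (S₁.smul_mem 3 h2) (S₁.smul_mem 2 h1)
    convert h3 using 1
    push_cast
    module
  · exact ⟨_, K.add_mem hvK (K.smul_mem _ huK), h _ (by positivity) (by linarith), h1,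
      hmem _ (by positivity)⟩

theorem exists_pos_notMem_notMem {T : W →ₗ[ℂ] W} (hT : T.IsSymmetric) {K S₁ S₂ : Submodule ℂ W}
    {v : W} (hvK : v ∈ K) (hv : 0 < quad T v) (hS₁ : ¬ K ≤ S₁) (hS₂ : ¬ K ≤ S₂) :
    ∃ w ∈ K, 0 < quad T w ∧ w ∉ S₁ ∧ w ∉ S₂ := by
  obtain ⟨w, hwK, hw, -, hw₁⟩ := exists_pos_notMem hT (S₁ := ⊥) hvK hv
    (by rintro h; rw [Submodule.mem_bot] at h; simp [h] at hv) hS₁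
  exact exists_pos_notMem hT hwK hw hw₁ hS₂

variable [FiniteDimensional ℂ W]

/-- With `Q` maximal positive in `F`, the space `Q ⊔ Z` is nonnegative. It can meet the nonpositive
part of `V` only in isotropic vectors of `Z`, and these are orthogonal to all of `V`. -/
theorem idx_add_finrank_le_idx {T : W →ₗ[ℂ] W} (hT : T.IsSymmetric) {F V Z : Submodule ℂ W}
    (hFV : F ≤ V) (hZF : Z ≤ F) (hZ : Z ≤ orth T F) :
    idx T F + finrank ℂ Z ≤ idx T V + finrank ℂ (Z ⊓ orth T V : Submodule ℂ W) := by
  obtain ⟨P, hP, hpos, hr⟩ := exists_idx T V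
  obtain ⟨Q, hQ, hQpos, hQr⟩ := exists_idx T F
  have hK := quad_nonpos_of_maximal hT hP hpos hr
  have hVP := hpos.sup_inf_orth hP
  have hZ0 : ∀ z ∈ Z, quad T z = 0 := fun z hz => by
    rw [quad, mem_orth.1 (hZ hz) z (hZF hz), Complex.zero_re]
  have hQZ : Q ⊓ Z = ⊥ := hQpos.inf_eq_bot fun z hz => (hZ0 z hz).le
  have hle : (Q ⊔ Z) ⊓ (V ⊓ orth T P) ≤ Z ⊓ orth T V := by
    rintro x ⟨hx, hxK⟩
    obtain ⟨y, hy, z, hz, rfl⟩ := Submodule.mem_sup.1 hx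
    have h1 := hK _ hxK
    rw [quad_add_of_orth hT (mem_orth.1 (hZ hz) y (hQ hy)), hZ0 z hz, add_zero] at h1
    have hy0 : y = 0 := by
      by_contra h0
      exact absurd (hQpos y hy h0) (not_lt.2 h1)
    subst hy0
    rw [zero_add] at hxK ⊢
    refine ⟨hz, ?_⟩
    rw [← hVP, orth_sup]
    exact ⟨hxK.2, mem_orth_of_semidefinite hT hK hxK (hZ0 z hz)⟩
  have h1 := Submodule.finrank_mono hle
  have h2 := Submodule.finrank_sup_add_finrank_inf_eq (Q ⊔ Z) (V ⊓ orth T P)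
  have h3 := Submodule.finrank_sup_add_finrank_inf_eq Q Z
  have h4 := Submodule.finrank_mono
    (sup_le (sup_le (hQ.trans hFV) (hZF.trans hFV)) inf_le_left : (Q ⊔ Z) ⊔ (V ⊓ orth T P) ≤ V)
  have h5 := Submodule.finrank_add_le_finrank_add_finrank P (V ⊓ orth T P)
  rw [hVP] at h5
  rw [hQZ, finrank_bot] at h3
  omega

theorem idx_lower_bound_left {T : W →ₗ[ℂ] W} (hT : T.IsSymmetric) {F G V : Submodule ℂ W}
    (hFV : F ≤ V) (hVG : V ⊔ G = ⊤) :
    idx T F + finrank ℂ (F ⊓ orth T (F ⊔ G) : Submodule ℂ W) ≤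
      idx T V + finrank ℂ (F ⊓ LinearMap.ker T : Submodule ℂ W) := by
  have h := idx_add_finrank_le_idx hT hFV (inf_le_left : F ⊓ orth T (F ⊔ G) ≤ F)
    (inf_le_right.trans (orth_anti T le_sup_left))
  -- Such vectors are orthogonal to both `V` and `G`, hence to everything.
  have h2 : (F ⊓ orth T (F ⊔ G)) ⊓ orth T V ≤ F ⊓ LinearMap.ker T := by
    refine le_inf (inf_le_left.trans inf_le_left) ?_
    rw [← orth_top hT, ← hVG, orth_sup T V]
    exact le_inf inf_le_right
      (inf_le_left.trans (inf_le_right.trans (orth_anti T le_sup_right)))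
  have := Submodule.finrank_mono h2
  omega

/-- Adding `ker T` to `V` leaves the index unchanged, and `V ⊔ ker T` has codimension `dim G - dim
(G ⊓ (V ⊔ ker T))`, which is at most the value with `F` in place of `V`. -/
theorem idx_lower_bound_right {T : W →ₗ[ℂ] W} (hT : T.IsSymmetric) {F G V : Submodule ℂ W}
    (hFV : F ≤ V) (hVG : V ⊔ G = ⊤) :
    idx T ⊤ + finrank ℂ (G ⊓ (F ⊔ LinearMap.ker T) : Submodule ℂ W) ≤
      idx T V + finrank ℂ G := by
  have h1 := idx_add_finrank_le T (le_top : V ⊔ LinearMap.ker T ≤ ⊤)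
  have h2 : idx T (V ⊔ LinearMap.ker T) ≤ idx T V :=
    idx_sup_le_of_nonpos hT (ker_le_orth hT _) fun x hx => (quad_eq_zero_of_mem_ker hx).le
  have h3 := Submodule.finrank_sup_add_finrank_inf_eq G (V ⊔ LinearMap.ker T)
  have h4 : G ⊔ (V ⊔ LinearMap.ker T) = ⊤ := by
    rw [eq_top_iff, ← hVG]
    exact sup_le (le_sup_left.trans le_sup_right) le_sup_left
  have h5 := Submodule.finrank_mono
    (inf_le_inf_left G (sup_le_sup_right hFV (LinearMap.ker T)))
  rw [h4] at h3
  omega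

/-- Combine a positive `e` orthogonal to `F` with a negative `f` orthogonal to `F` and `e`, scaled
so that their forms cancel. The phase of `f` stays free and serves to avoid `S₁` and `S₂`. -/
theorem exists_isotropic_notMem {T : W →ₗ[ℂ] W} (hT : T.IsSymmetric) {F S₁ S₂ : Submodule ℂ W}
    (hN : LinearMap.ker T ≤ F)
    (hp : finrank ℂ F < idx T ⊤ + idx (-T) F + finrank ℂ (LinearMap.ker T))
    (hn : finrank ℂ F < idx (-T) ⊤ + idx T F + finrank ℂ (LinearMap.ker T))
    (hS₁ : ¬ orth T F ≤ S₁) (hS₂ : ¬ orth T F ≤ S₂) :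
    ∃ w ∈ orth T F, quad T w = 0 ∧ w ∉ S₁ ∧ w ∉ S₂ := by
  obtain ⟨v, hv, hvpos⟩ := exists_pos_mem_orth hT hN hp
  obtain ⟨e, he, hepos, he₁, he₂⟩ := exists_pos_notMem_notMem hT hv hvpos hS₁ hS₂
  -- Adjoining `e` raises the dimension by at most one and the index by at least one, so `hn`
  -- survives for `F ⊔ (ℂ ∙ e)`.
  have hidx : idx T F + 1 ≤ idx T (F ⊔ (ℂ ∙ e)) := by
    obtain ⟨P, hP, hpos, hr⟩ := exists_idx T F
    have heo := (Submodule.span_singleton_le_iff_mem _ _).2 (orth_anti T hP he)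
    have h1 := le_idx (sup_le_sup_right hP _) (hpos.sup hT (posOn_span_singleton hepos) heo)
    have h2 : e ∉ P := fun h => by
      have : e ∈ P ⊓ orth T P := ⟨h, orth_anti T hP he⟩
      rw [hpos.inf_orth, Submodule.mem_bot] at this
      simp [this] at hepos
    rw [finrank_sup_span_of_notMem h2] at h1
    omega
  have hfr : finrank ℂ (F ⊔ (ℂ ∙ e) : Submodule ℂ W) ≤ finrank ℂ F + 1 := by
    refine (Submodule.finrank_add_le_finrank_add_finrank _ _).trans ?_
    exact Nat.add_le_add_left ((finrank_span_le_card {e}).trans (by simp)) _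
  obtain ⟨f, hf, hfneg⟩ := exists_pos_mem_orth (isSymmetric_neg hT) (F := F ⊔ (ℂ ∙ e))
    (by rw [ker_neg]; exact hN.trans le_sup_left) (by rw [neg_neg, ker_neg]; omega)
  rw [orth_neg, orth_sup] at hf
  rw [quad_neg, neg_pos] at hfneg
  obtain ⟨ζ, hζ, h₁, h₂⟩ := exists_norm_one_add_smul_notMem he₁ he₂
    ((Real.sqrt (quad T e / -quad T f) : ℂ) • f)
  refine ⟨_, Submodule.add_mem _ he (Submodule.smul_mem _ _ (Submodule.smul_mem _ _ hf.1)), ?_,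
    h₁, h₂⟩
  rw [quad_add_of_orth hT, quad_smul, quad_smul, hζ, Complex.norm_real, Real.norm_eq_abs, sq_abs,
    Real.sq_sqrt (div_nonneg hepos.le (by linarith))]
  · have : quad T f ≠ 0 := hfneg.ne
    field_simp
    ring
  · have := mem_orth.1 hf.2 e (Submodule.mem_span_singleton_self e)
    simp [this]

/-- A subspace between `F` and `W` that is a complement of `G` and has large positive index. -/
theorem exists_isCompl_idx_ge {T : W →ₗ[ℂ] W} (hT : T.IsSymmetric) {F G : Submodule ℂ W}
    (hFG : Disjoint F G) :
    ∃ V, F ≤ V ∧ IsCompl V G ∧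
      (idx T F + finrank ℂ W ≤ idx T V + finrank ℂ F + finrank ℂ G ∨ idx T ⊤ ≤ idx T V) := by
  by_cases hlt : idx T ⊤ ≤ idx T F
  · obtain ⟨V, -, hFV, hV⟩ := exists_isCompl_ge (le_top : F ≤ ⊤) hFG (top_sup_eq G)
    exact ⟨V, hFV, hV, Or.inr (hlt.trans (idx_mono T hFV))⟩
  by_cases htop : F ⊔ G = ⊤
  · refine ⟨F, le_rfl, ⟨hFG, codisjoint_iff.2 htop⟩, Or.inl ?_⟩
    have h1 := Submodule.finrank_sup_add_finrank_inf_eq F G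
    rw [htop, finrank_top] at h1
    omega
  -- For the index to grow it suffices that the new vector is positive and orthogonal to a maximal
  -- positive `P ≤ F`, not to `F` itself. One exists because `idx T ⊤` exceeds `dim P`.
  obtain ⟨P, hP, hpos, hr⟩ := exists_idx T F
  obtain ⟨P', -, hpos', hr'⟩ := exists_idx T ⊤
  have h1 := finrank_add_le P' (orth T P)
  have h2 := finrank_orth (T := T) P
  have h3 : P' ⊓ orth T P ≠ ⊥ := by
    intro h; rw [h, finrank_bot] at h1; omega
  obtain ⟨v, hv, hv0⟩ := Submodule.exists_mem_ne_zero_of_ne_bot h3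
  have hK : ¬ orth T P ≤ F ⊔ G := by
    intro h
    apply htop
    rw [eq_top_iff, ← hpos.sup_orth]
    exact sup_le (hP.trans le_sup_left) h
  obtain ⟨w, hwo, hwpos, -, hw⟩ := exists_pos_notMem_notMem hT hv.2 (hpos' v hv.1 hv0) hK hK
  have hwF : w ∉ F := fun h => hw ((le_sup_left : F ≤ _) h)
  have hfr := finrank_sup_span_of_notMem hwF
  obtain ⟨V, hFV, hV, h⟩ := exists_isCompl_idx_ge hT (disjoint_sup_span hFG hw)
  -- Dimension and index rise together, so `idx T F - dim F` does not drop along the recursion.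
  refine ⟨V, le_sup_left.trans hFV, hV, h.imp_left fun h => ?_⟩
  have h4 := le_idx (sup_le_sup_right hP _) (hpos.sup hT (posOn_span_singleton hwpos)
    ((Submodule.span_singleton_le_iff_mem _ _).2 hwo))
  rw [finrank_sup_span_of_notMem fun h => hwF (hP h)] at h4
  omega
termination_by finrank ℂ W - finrank ℂ F
decreasing_by
  have := Submodule.finrank_le (F ⊔ (ℂ ∙ w))
  omega

/-- One step of the construction of a complement of `G` with small index: the next vector `w`. -/
theorem exists_extension_vector {T : W →ₗ[ℂ] W} (hT : T.IsSymmetric) {F G : Submodule ℂ W}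
    (hN : LinearMap.ker T ≤ F) (hFG : Disjoint F G) (htop : F ⊔ G ≠ ⊤)
    (hZ : F ⊓ orth T (F ⊔ G) ≤ LinearMap.ker T) :
    ∃ w ∈ orth T F, w ∉ F ⊔ G ∧
      (F ⊔ (ℂ ∙ w)) ⊓ orth T ((F ⊔ (ℂ ∙ w)) ⊔ G) ≤ LinearMap.ker T ∧
      (0 < quad T w → idx T F + finrank ℂ G < idx T ⊤) ∧
      (quad T w < 0 → idx (-T) F + finrank ℂ G < idx (-T) ⊤) := by
  have hfin := Submodule.finrank_sup_add_finrank_inf_eq F G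
  rw [hFG.eq_bot, finrank_bot, add_zero] at hfin
  have hlt := Submodule.finrank_lt htop
  have hS := finrank_eq_idx_add_idx hT F
  have hS' := finrank_eq_idx_add_idx hT (⊤ : Submodule ℂ W)
  rw [orth_top hT, top_inf_eq, finrank_top] at hS'
  have hRG : (F ⊓ orth T F) ⊓ orth T G ≤ LinearMap.ker T := by
    rw [inf_assoc, ← orth_sup]; exact hZ
  have hRN : LinearMap.ker T ≤ F ⊓ orth T F := le_inf hN (ker_le_orth hT F)
  -- Modulo `ker T`, the form pairs the radical of `F` with `G` without degeneracy on the radical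
  -- side.
  have hR : finrank ℂ (F ⊓ orth T F : Submodule ℂ W) ≤
      finrank ℂ G + finrank ℂ (LinearMap.ker T) := by
    have h1 := finrank_add_le (F ⊓ orth T F) (orth T G)
    have h2 := finrank_orth (T := T) G
    have h3 := Submodule.finrank_mono hRG
    have h4 : G ⊓ LinearMap.ker T = ⊥ := eq_bot_iff.2 fun x hx =>
      (Submodule.mem_bot ℂ).2 (Submodule.disjoint_def.1 hFG x (hN hx.2) hx.1)
    rw [h4, finrank_bot] at h2
    omega
  -- Otherwise taking orthogonals puts `orth T (F ⊔ G)` inside `F`, hence inside `ker T` by `hZ`,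
  -- and `F ⊔ G` would be everything.
  have hnot : ¬ orth T F ≤ F ⊔ G := by
    intro h
    have h1 : orth T (F ⊔ G) ≤ F := by
      refine (orth_anti T h).trans ?_
      rw [orth_orth hT]
      exact sup_le le_rfl hN
    have h2 : orth T (F ⊔ G) ≤ LinearMap.ker T := fun x hx => hZ ⟨h1 hx, hx⟩
    have h3 := orth_anti T h2
    rw [orth_orth hT] at h3
    have h4 : orth T (LinearMap.ker T) = ⊤ := by
      rw [eq_top_iff, le_orth_comm hT, orth_top hT]
    rw [h4] at h3
    exact htop (eq_top_iff.2 (h3.trans (sup_le le_rfl (hN.trans le_sup_left))))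
  -- An anisotropic `w` orthogonal to `F` adds nothing to the radical, so `hZ` persists.
  have hdef : ∀ w ∈ orth T F, quad T w ≠ 0 →
      (F ⊔ (ℂ ∙ w)) ⊓ orth T ((F ⊔ (ℂ ∙ w)) ⊔ G) ≤ LinearMap.ker T := by
    rintro w hw hq x ⟨hx, hxo⟩
    obtain ⟨f, hf, y, hy, rfl⟩ := Submodule.mem_sup.1 hx
    obtain ⟨c, rfl⟩ := Submodule.mem_span_singleton.1 hy
    rw [orth_sup, orth_sup] at hxo
    have h1 := mem_orth.1 hxo.1.2 w (Submodule.mem_span_singleton_self w)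
    rw [inner_add_right, inner_smul_right, (mem_orth' hT).1 hw f hf, zero_add] at h1
    have hc : c = 0 := by
      rcases mul_eq_zero.1 h1 with h | h
      · exact h
      · exact absurd (by rw [quad, h, Complex.zero_re]) hq
    subst hc
    rw [zero_smul, add_zero] at hxo ⊢
    refine hZ ⟨hf, ?_⟩
    rw [orth_sup]
    exact ⟨hxo.1.1, hxo.2⟩
  by_cases hp : idx T F + finrank ℂ G < idx T ⊤
  · obtain ⟨v, hv, hvpos⟩ := exists_pos_mem_orth hT hN (by omega)
    obtain ⟨w, hwo, hwpos, -, hw⟩ := exists_pos_notMem_notMem hT hv hvpos hnot hnot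
    exact ⟨w, hwo, hw, hdef w hwo hwpos.ne', fun _ => hp, fun h => absurd h hwpos.asymm⟩
  by_cases hn : idx (-T) F + finrank ℂ G < idx (-T) ⊤
  · obtain ⟨v, hv, hvpos⟩ := exists_pos_mem_orth (isSymmetric_neg hT) (F := F)
      (by rwa [ker_neg]) (by rw [neg_neg, ker_neg]; omega)
    rw [← orth_neg] at hnot
    obtain ⟨w, hwo, hwpos, -, hw⟩ :=
      exists_pos_notMem_notMem (isSymmetric_neg hT) hv hvpos hnot hnot
    rw [quad_neg, neg_pos] at hwpos
    rw [orth_neg] at hwo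
    exact ⟨w, hwo, hw, hdef w hwo hwpos.ne, fun h => absurd h hwpos.asymm, fun _ => hn⟩
  -- No index has room left, so `w` must be isotropic. It then enters the radical, and `hZ` persists
  -- only if `w` avoids `orth T G` plus the old radical. If that were impossible, counting
  -- dimensions with `hp` and `hn` would force `F ⊔ G = ⊤`.
  have hnot₂ : ¬ orth T F ≤ orth T G ⊔ F ⊓ orth T F := by
    intro h
    have h1 := orth_anti T h
    rw [orth_sup, orth_orth hT, orth_orth hT, sup_eq_left.2 hN] at h1
    have h2 : G ⊓ orth T (F ⊓ orth T F) = ⊥ := eq_bot_iff.2 fun x hx =>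
      (Submodule.mem_bot ℂ).2 (Submodule.disjoint_def.1 hFG x
        (h1 ⟨(le_sup_left : G ≤ _) hx.1, hx.2⟩) hx.1)
    have h3 := finrank_add_le G (orth T (F ⊓ orth T F))
    have h4 := finrank_orth (T := T) (F ⊓ orth T F)
    rw [inf_eq_right.2 hRN] at h4
    rw [h2, finrank_bot] at h3
    omega
  obtain ⟨w, hwo, hw0, hw, hw₂⟩ :=
    exists_isotropic_notMem hT hN (by omega) (by omega) hnot hnot₂
  refine ⟨w, hwo, hw, ?_, fun h => absurd hw0 h.ne', fun h => absurd hw0 h.ne⟩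
  rintro x ⟨hx, hxo⟩
  obtain ⟨f, hf, y, hy, rfl⟩ := Submodule.mem_sup.1 hx
  obtain ⟨c, rfl⟩ := Submodule.mem_span_singleton.1 hy
  rw [orth_sup, orth_sup] at hxo
  have hfo : f ∈ orth T F :=
    ((orth T F).add_mem_iff_left (Submodule.smul_mem _ c hwo)).1 hxo.1.1
  by_cases hc : c = 0
  · subst hc
    rw [zero_smul, add_zero] at hxo ⊢
    exact hRG ⟨⟨hf, hfo⟩, hxo.2⟩
  · refine absurd ?_ hw₂
    rw [← Submodule.smul_mem_iff _ hc]
    have h5 : c • w = (f + c • w) + -f := by abel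
    rw [h5]
    exact Submodule.add_mem_sup hxo.2 (Submodule.neg_mem _ ⟨hf, hfo⟩)

/-- Recursion on the codimension of `F`. While `Z = F ⊓ orth T (F ⊔ G)` exceeds `ker T`, a vector
not orthogonal to `Z` shrinks `Z` and raises each index by at most one, keeping the first
alternative. Once `Z` is `ker T`, `exists_extension_vector` raises an index only while it is below
the second alternative. -/
theorem exists_isCompl_idx_le_of_ker_le {T : W →ₗ[ℂ] W} (hT : T.IsSymmetric) {F G : Submodule ℂ W}
    (hN : LinearMap.ker T ≤ F) (hFG : Disjoint F G) :
    ∃ V, F ≤ V ∧ IsCompl V G ∧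
      (idx T V + finrank ℂ (LinearMap.ker T) ≤
          idx T F + finrank ℂ (F ⊓ orth T (F ⊔ G) : Submodule ℂ W) ∨
        idx T V + finrank ℂ G ≤ idx T ⊤) ∧
      (idx (-T) V + finrank ℂ (LinearMap.ker T) ≤
          idx (-T) F + finrank ℂ (F ⊓ orth T (F ⊔ G) : Submodule ℂ W) ∨
        idx (-T) V + finrank ℂ G ≤ idx (-T) ⊤) := by
  have hNZ : LinearMap.ker T ≤ F ⊓ orth T (F ⊔ G) := le_inf hN (ker_le_orth hT _)
  have hNZr := Submodule.finrank_mono hNZ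
  by_cases htop : F ⊔ G = ⊤
  · exact ⟨F, le_rfl, ⟨hFG, codisjoint_iff.2 htop⟩, Or.inl (by omega), Or.inl (by omega)⟩
  have hN' : ∀ w : W, LinearMap.ker T ≤ F ⊔ (ℂ ∙ w) := fun w => hN.trans le_sup_left
  by_cases hZ : F ⊓ orth T (F ⊔ G) ≤ LinearMap.ker T
  · obtain ⟨w, hwo, hw, hZ', hp, hn⟩ := exists_extension_vector hT hN hFG htop hZ
    have hwF : w ∉ F := fun h => hw ((le_sup_left : F ≤ _) h)
    have hfr := finrank_sup_span_of_notMem hwF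
    obtain ⟨V, hFV, hV, h₁, h₂⟩ :=
      exists_isCompl_idx_le_of_ker_le hT (hN' w) (disjoint_sup_span hFG hw)
    have hZr := Submodule.finrank_mono hZ'
    have h3 := idx_add_finrank_le T (le_sup_left : F ≤ F ⊔ (ℂ ∙ w))
    have h4 := idx_add_finrank_le (-T) (le_sup_left : F ≤ F ⊔ (ℂ ∙ w))
    refine ⟨V, le_sup_left.trans hFV, hV, ?_, ?_⟩
    · rcases le_or_gt (quad T w) 0 with hq | hq
      · have := idx_sup_span_le hT hwo hq
        omega
      · have := hp hq
        omega
    · rcases le_or_gt 0 (quad T w) with hq | hq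
      · have := idx_sup_span_le (isSymmetric_neg hT) (F := F) (w := w) (by rwa [orth_neg])
          (by rw [quad_neg]; linarith)
        omega
      · have := hn hq
        omega
  · obtain ⟨z, hz, hzN⟩ := SetLike.not_le_iff_exists.1 hZ
    have hTz : T z ≠ 0 := fun h => hzN (LinearMap.mem_ker.2 h)
    -- The vector `T z` pairs nontrivially with `z`; it lies outside `F ⊔ G` because `z` is
    -- orthogonal to that space.
    obtain ⟨w, hwz⟩ : ∃ w, inner ℂ (T w) z ≠ 0 := ⟨T z, by rw [hT]; exact inner_self_ne_zero.2 hTz⟩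
    have hw : w ∉ F ⊔ G := fun h => hwz (mem_orth.1 hz.2 w h)
    have hwF : w ∉ F := fun h => hw ((le_sup_left : F ≤ _) h)
    have hfr := finrank_sup_span_of_notMem hwF
    obtain ⟨V, hFV, hV, h₁, h₂⟩ :=
      exists_isCompl_idx_le_of_ker_le hT (hN' w) (disjoint_sup_span hFG hw)
    have h3 := idx_add_finrank_le T (le_sup_left : F ≤ F ⊔ (ℂ ∙ w))
    have h4 := idx_add_finrank_le (-T) (le_sup_left : F ≤ F ⊔ (ℂ ∙ w))
    have hZ' : (F ⊔ (ℂ ∙ w)) ⊓ orth T ((F ⊔ (ℂ ∙ w)) ⊔ G) < F ⊓ orth T (F ⊔ G) := by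
      refine lt_of_le_of_ne ?_ ?_
      · rintro x ⟨hx, hxo⟩
        have hxo' := orth_anti T (sup_le_sup_right (le_sup_left : F ≤ F ⊔ (ℂ ∙ w)) G) hxo
        obtain ⟨f, hf, y, hy, rfl⟩ := Submodule.mem_sup.1 hx
        obtain ⟨c, rfl⟩ := Submodule.mem_span_singleton.1 hy
        have h1 := (mem_orth' hT).1 hxo' z ((le_sup_left : F ≤ _) hz.1)
        rw [map_add, inner_add_left, map_smul, inner_smul_left,
          mem_orth.1 hz.2 f ((le_sup_left : F ≤ _) hf), zero_add] at h1
        have hc : c = 0 := by simpa using (mul_eq_zero.1 h1).resolve_right hwz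
        subst hc
        rw [zero_smul, add_zero] at hxo' ⊢
        exact ⟨hf, hxo'⟩
      · intro h
        rw [← h] at hz
        exact hwz (mem_orth.1 hz.2 w ((le_sup_left : F ⊔ (ℂ ∙ w) ≤ _)
          ((le_sup_right : (ℂ ∙ w) ≤ _) (Submodule.mem_span_singleton_self w))))
    have hZr := Submodule.finrank_lt_finrank_of_lt hZ'
    refine ⟨V, le_sup_left.trans hFV, hV, ?_, ?_⟩ <;> omega
termination_by finrank ℂ W - finrank ℂ F
decreasing_by
  all_goals
    have := Submodule.finrank_le (F ⊔ (ℂ ∙ w))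
    omega

/-- A complement of `G` containing `F` with both indices as small as possible. -/
theorem exists_isCompl_idx_le {T : W →ₗ[ℂ] W} (hT : T.IsSymmetric) {F G : Submodule ℂ W}
    (hFG : Disjoint F G) :
    ∃ V, F ≤ V ∧ IsCompl V G ∧
      (idx T V + finrank ℂ (F ⊓ LinearMap.ker T : Submodule ℂ W) ≤
          idx T F + finrank ℂ (F ⊓ orth T (F ⊔ G) : Submodule ℂ W) ∨
        idx T V + finrank ℂ G ≤
          idx T ⊤ + finrank ℂ (G ⊓ (F ⊔ LinearMap.ker T) : Submodule ℂ W)) ∧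
      (idx (-T) V + finrank ℂ (F ⊓ LinearMap.ker T : Submodule ℂ W) ≤
          idx (-T) F + finrank ℂ (F ⊓ orth T (F ⊔ G) : Submodule ℂ W) ∨
        idx (-T) V + finrank ℂ G ≤
          idx (-T) ⊤ + finrank ℂ (G ⊓ (F ⊔ LinearMap.ker T) : Submodule ℂ W)) := by
  set N := LinearMap.ker T with hNdef
  -- Reduction to the case `ker T ≤ F`: enlarge `F` to `F ⊔ N` and shrink `G` to a complement `S ⊓
  -- G` of `G ⊓ (F ⊔ N)` in `G`. The resulting `V` is too large and is cut down to a complement of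
  -- `G`, which cannot raise either index.
  obtain ⟨S, hS⟩ := Submodule.exists_isCompl (G ⊓ (F ⊔ N))
  have hG : G ⊓ (F ⊔ N) ⊔ S ⊓ G = G := by
    rw [← sup_inf_assoc_of_le _ inf_le_left, hS.sup_eq_top, top_inf_eq]
  have hdis : Disjoint (F ⊔ N) (S ⊓ G) := by
    rw [Submodule.disjoint_def]
    exact fun x hx hxG => Submodule.disjoint_def.1 hS.disjoint x ⟨hxG.2, hx⟩ hxG.1
  have hGr : finrank ℂ G ≤ finrank ℂ (G ⊓ (F ⊔ N) : Submodule ℂ W) +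
      finrank ℂ (S ⊓ G : Submodule ℂ W) := by
    conv_lhs => rw [← hG]
    exact Submodule.finrank_add_le_finrank_add_finrank _ _
  obtain ⟨V, hFV, hV, h₁, h₂⟩ :=
    exists_isCompl_idx_le_of_ker_le hT (F := F ⊔ N) le_sup_right hdis
  rw [← hNdef] at h₁ h₂
  obtain ⟨V', hV'V, hFV', hV'⟩ := exists_isCompl_ge (le_sup_left.trans hFV) hFG
    (eq_top_iff.2 (hV.sup_eq_top.symm.le.trans (sup_le_sup_left inf_le_right V)))
  have hsup : F ⊔ N ⊔ S ⊓ G = F ⊔ N ⊔ G := by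
    apply le_antisymm (sup_le_sup_left inf_le_right _)
    refine sup_le le_sup_left ?_
    conv_lhs => rw [← hG]
    exact sup_le (inf_le_right.trans le_sup_left) le_sup_right
  have horth : orth T (F ⊔ N ⊔ G) = orth T (F ⊔ G) := by
    rw [sup_right_comm, orth_sup T (F ⊔ G), inf_eq_left]
    exact (le_orth_comm hT).1 (ker_le_orth hT _)
  have hZ : (F ⊔ N) ⊓ orth T (F ⊔ N ⊔ S ⊓ G) = N ⊔ F ⊓ orth T (F ⊔ G) := by
    rw [hsup, horth, sup_comm F N, sup_inf_assoc_of_le _ (ker_le_orth hT _)]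
  have hZr := Submodule.finrank_sup_add_finrank_inf_eq N (F ⊓ orth T (F ⊔ G))
  have hinf : N ⊓ (F ⊓ orth T (F ⊔ G)) = F ⊓ N := by
    rw [← inf_assoc, inf_comm N F, inf_eq_left]
    exact inf_le_right.trans (ker_le_orth hT _)
  rw [hinf, ← hZ] at hZr
  have hp : idx T (F ⊔ N) ≤ idx T F :=
    idx_sup_le_of_nonpos hT (ker_le_orth hT _) fun x hx => (quad_eq_zero_of_mem_ker hx).le
  have hn : idx (-T) (F ⊔ N) ≤ idx (-T) F :=
    idx_sup_le_of_nonpos (isSymmetric_neg hT) (by rw [orth_neg]; exact ker_le_orth hT _)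
      fun x hx => by rw [quad_neg, quad_eq_zero_of_mem_ker hx, neg_zero]
  have h3 := idx_mono T hV'V
  have h4 := idx_mono (-T) hV'V
  refine ⟨V', hFV', hV', ?_, ?_⟩ <;> omega

end Extremal

end QuadInertia

namespace QuadInertia

open Module
open scoped ComplexOrder

/-! ### Generic ranks of matrix functions and the maximal rank of `φ`. -/

section Rank

variable {a b c d : Type*}

theorem fromCols_add_fromCols (A B : Matrix a b ℂ) (A' B' : Matrix a c ℂ) :
    fromCols A A' + fromCols B B' = fromCols (A + B) (A' + B') := by
  ext i (j | j) <;> rfl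

theorem fromRows_add_fromRows (A B : Matrix b a ℂ) (A' B' : Matrix c a ℂ) :
    fromRows A A' + fromRows B B' = fromRows (A + B) (A' + B') := by
  ext (i | i) j <;> rfl

theorem rank_fromCols_rotate [Fintype b] [Fintype c] [Fintype d] (A : Matrix a b ℂ)
    (B : Matrix a c ℂ) (C : Matrix a d ℂ) :
    (fromCols (fromCols A B) C).rank = (fromCols (fromCols C B) A).rank := by
  rw [← rank_submatrix (fromCols (fromCols C B) A) (Equiv.refl a)
    ((Equiv.sumComm _ _).trans (((Equiv.refl d).sumCongr (Equiv.sumComm b c)).trans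
      (Equiv.sumAssoc d c b).symm))]
  congr 1
  ext i ((j | j) | j) <;> rfl

variable [Fintype b]

theorem rank_add_finrank_ker (A : Matrix a b ℂ) :
    A.rank + finrank ℂ (LinearMap.ker A.mulVecLin) = Fintype.card b := by
  rw [Matrix.rank, LinearMap.finrank_range_add_finrank_ker, Module.finrank_fintype_fun_eq_card]

theorem exists_mulVec_notMem_range [Fintype c] {A : Matrix a b ℂ} {B : Matrix a c ℂ}
    (h : A.rank < (fromCols A B).rank) :
    ∃ y, B *ᵥ y ∉ LinearMap.range A.mulVecLin := by
  by_contra! hcon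
  refine absurd h (not_lt.2 (Submodule.finrank_mono ?_))
  rintro _ ⟨v, rfl⟩
  rw [mulVecLin_apply, fromCols_mulVec]
  exact Submodule.add_mem _ ⟨_, rfl⟩ (hcon _)

theorem exists_mem_ker_mulVec_ne_zero {A : Matrix a b ℂ} {C : Matrix c b ℂ}
    (h : A.rank < (fromRows A C).rank) : ∃ x, A *ᵥ x = 0 ∧ C *ᵥ x ≠ 0 := by
  by_contra! hcon
  have h1 : LinearMap.ker A.mulVecLin ≤ LinearMap.ker (fromRows A C).mulVecLin := by
    intro x hx
    rw [LinearMap.mem_ker, mulVecLin_apply] at hx ⊢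
    rw [fromRows_mulVec, hx, hcon x hx]
    ext i; cases i <;> rfl
  have h2 := Submodule.finrank_mono h1
  have h3 := rank_add_finrank_ker A
  have h4 := rank_add_finrank_ker (fromRows A C)
  omega

/-- As `u` is outside the range of `A`, the kernel of the sum is the part of `ker A` annihilated by
`v`, and it loses `x`. -/
theorem rank_lt_rank_add_vecMulVec {A : Matrix a b ℂ} {u : a → ℂ} {v x : b → ℂ}
    (hu : u ∉ LinearMap.range A.mulVecLin) (hx : A *ᵥ x = 0) (hv : v ⬝ᵥ x ≠ 0) :
    A.rank < (A + vecMulVec u v).rank := by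
  have h1 : LinearMap.ker (A + vecMulVec u v).mulVecLin < LinearMap.ker A.mulVecLin := by
    have key : ∀ y, (A + vecMulVec u v) *ᵥ y = 0 → v ⬝ᵥ y = 0 := by
      intro y hy
      by_contra h0
      refine hu ⟨-(v ⬝ᵥ y)⁻¹ • y, ?_⟩
      rw [add_mulVec, vecMulVec_mulVec, add_eq_zero_iff_eq_neg] at hy
      rw [map_smul, mulVecLin_apply, hy]
      ext i
      simp [field]
    refine lt_of_le_of_ne (fun y hy => ?_) fun h => ?_
    · rw [LinearMap.mem_ker, mulVecLin_apply] at hy ⊢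
      have h2 := key y hy
      rw [add_mulVec, vecMulVec_mulVec, h2] at hy
      simpa using hy
    · have h2 : x ∈ LinearMap.ker (A + vecMulVec u v).mulVecLin := by
        rw [h]; simpa using hx
      exact hv (key x h2)
  have h2 := Submodule.finrank_lt_finrank_of_lt h1
  have h3 := rank_add_finrank_ker A
  have h4 := rank_add_finrank_ker (A + vecMulVec u v)
  omega

variable [Fintype a] [Fintype c] [Fintype d]

/-- The generic rank of the linear matrix function `A + B X C`. -/
theorem exists_rank_add_mul_mul_ge [DecidableEq a] [DecidableEq b] [DecidableEq c] [DecidableEq d]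
    (A : Matrix a b ℂ) (B : Matrix a c ℂ) (C : Matrix d b ℂ) :
    ∃ X : Matrix c d ℂ, min (fromCols A B).rank (fromRows A C).rank ≤ (A + B * X * C).rank := by
  -- Take `X` of maximal rank; below the bound, a rank-one change of `X` would raise the rank.
  obtain ⟨X, hX⟩ : ∃ X : Matrix c d ℂ, ∀ Y : Matrix c d ℂ,
      (A + B * Y * C).rank ≤ (A + B * X * C).rank := by
    have hb : BddAbove (Set.range fun X : Matrix c d ℂ => (A + B * X * C).rank) :=
      ⟨Fintype.card b, by rintro _ ⟨X, rfl⟩; exact rank_le_card_width _⟩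
    obtain ⟨X, hX⟩ := Nat.sSup_mem (Set.range_nonempty _) hb
    exact ⟨X, fun Y => (le_csSup hb ⟨Y, rfl⟩).trans hX.ge⟩
  refine ⟨X, ?_⟩
  by_contra! hlt
  obtain ⟨h1, h2⟩ := lt_min_iff.1 hlt
  -- Block operations absorb `B * X * C`, so the bounds may be read at `A + B * X * C`.
  have e1 : fromCols A B = fromCols (A + B * X * C) B *
      (fromBlocks 1 0 (-(X * C)) 1 : Matrix (b ⊕ c) (b ⊕ c) ℂ) := by
    rw [fromCols_mul_fromBlocks]
    simp [Matrix.mul_assoc]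
  have e2 : fromRows A C = (fromBlocks 1 (-(B * X)) 0 1 : Matrix (a ⊕ d) (a ⊕ d) ℂ) *
      fromRows (A + B * X * C) C := by
    rw [fromBlocks_mul_fromRows]
    simp
  rw [e1] at h1
  rw [e2] at h2
  obtain ⟨y, hy⟩ := exists_mulVec_notMem_range (h1.trans_le (rank_mul_le_left _ _))
  obtain ⟨x, hx, hCx⟩ := exists_mem_ker_mulVec_ne_zero (h2.trans_le (rank_mul_le_right _ _))
  -- This `v` pairs with `x` to `‖C x‖² ≠ 0`.
  have h3 := rank_lt_rank_add_vecMulVec (v := star (C *ᵥ x) ᵥ* C) hy hx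
    (by rw [← dotProduct_mulVec]; exact fun h => hCx (dotProduct_star_self_eq_zero.1 h))
  refine absurd (hX (X + vecMulVec y (star (C *ᵥ x)))) (not_le.2 ?_)
  rwa [Matrix.mul_add, Matrix.add_mul, mul_vecMulVec, vecMulVec_mul, ← add_assoc]

/-- Turns a rank bound into a nonzero determinant, which can then be followed as a polynomial. -/
theorem exists_mul_mul_eq_one {A : Matrix a b ℂ} {k : ℕ} [DecidableEq b] [DecidableEq a]
    (h : k ≤ A.rank) :
    ∃ (R : Matrix (Fin k) a ℂ) (S : Matrix b (Fin k) ℂ), R * A * S = 1 := by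
  obtain ⟨f, hf⟩ := exists_linearIndependent_of_le_finrank h
  choose x hx using fun i => (f i).2
  have hli : LinearIndependent ℂ fun i => A *ᵥ x i := by
    have := hf.map' (Submodule.subtype _) (Submodule.ker_subtype _)
    rwa [show (fun i => A *ᵥ x i) = (Submodule.subtype _) ∘ f from funext hx]
  have hinj : Function.Injective (A * (Matrix.of x)ᵀ).mulVec := by
    rw [Matrix.mulVec_injective_iff]
    exact hli
  obtain ⟨g, hg⟩ := LinearMap.exists_leftInverse_of_injective (A * (Matrix.of x)ᵀ).mulVecLin
    (LinearMap.ker_eq_bot.2 hinj)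
  refine ⟨LinearMap.toMatrix' g, (Matrix.of x)ᵀ, ?_⟩
  have := congrArg LinearMap.toMatrix' hg
  rw [LinearMap.toMatrix'_comp, ← Matrix.toLin'_apply', LinearMap.toMatrix'_toLin', LinearMap.toMatrix'_id] at this
  rw [Matrix.mul_assoc, this]

/-- The rank of a quadratic matrix polynomial is generically at least its rank at any point. -/
theorem finite_rank_lt (A₀ A₁ A₂ : Matrix a b ℂ) [DecidableEq a] [DecidableEq b] {k : ℕ} {t₀ : ℂ}
    (h : k ≤ (A₀ + t₀ • A₁ + t₀ ^ 2 • A₂).rank) :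
    {t : ℂ | (A₀ + t • A₁ + t ^ 2 • A₂).rank < k}.Finite := by
  obtain ⟨R, S, hRS⟩ := exists_mul_mul_eq_one h
  let P : Polynomial ℂ := Matrix.det (((R * A₀ * S).map Polynomial.C +
    (Polynomial.X : Polynomial ℂ) • (R * A₁ * S).map Polynomial.C +
    (Polynomial.X ^ 2 : Polynomial ℂ) • (R * A₂ * S).map Polynomial.C :
      Matrix (Fin k) (Fin k) (Polynomial ℂ)))
  have hP : ∀ t, P.eval t = (R * (A₀ + t • A₁ + t ^ 2 • A₂) * S).det := by
    intro t
    rw [← Polynomial.coe_evalRingHom, RingHom.map_det]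
    congr 1
    simp only [Matrix.mul_add, Matrix.add_mul, Matrix.mul_smul, Matrix.smul_mul]
    generalize R * A₀ * S = B₀, R * A₁ * S = B₁, R * A₂ * S = B₂
    ext i j
    simp
    ring
  have hP0 : P ≠ 0 := by
    intro h0
    have := hP t₀
    rw [h0, hRS] at this
    simp at this
  refine (P.roots.toFinset.finite_toSet).subset fun t ht => ?_
  simp only [Finset.mem_coe, Multiset.mem_toFinset, Polynomial.mem_roots hP0, Polynomial.IsRoot, hP]
  by_contra hdet
  have h1 := rank_of_isUnit _ ((Matrix.isUnit_iff_isUnit_det _).2 (isUnit_iff_ne_zero.2 hdet))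
  have h2 := (rank_mul_le_left (R * (A₀ + t • A₁ + t ^ 2 • A₂)) S).trans
    (rank_mul_le_right R (A₀ + t • A₁ + t ^ 2 • A₂))
  rw [h1, Fintype.card_fin] at h2
  exact absurd ht (not_lt.2 h2)

variable {n p m : ℕ}

/-- The `star` in the second factor cancels the conjugation, so the expression is polynomial in `s`.
It is `φ(P + sQ)` for real `s`, while `s = i` gives two independent arguments. -/
theorem mul_star_add_eq_phi (A : Matrix (Fin n) (Fin p) ℂ) (C : Matrix (Fin n) (Fin m) ℂ)
    (M : Matrix (Fin m) (Fin m) ℂ) (D : Matrix (Fin n) (Fin n) ℂ)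
    (P Q : Matrix (Fin p) (Fin m) ℂ) (s : ℂ) :
    (A * (P + s • Q) + C) * M * (A * (P + star s • Q) + C)ᴴ + D =
      ((A * P + C) * M * (A * P + C)ᴴ + D) +
        s • (A * Q * M * (A * P + C)ᴴ + (A * P + C) * M * (A * Q)ᴴ) +
        s ^ 2 • (A * Q * M * (A * Q)ᴴ) := by
  have h1 : A * (P + s • Q) + C = (A * P + C) + s • (A * Q) := by
    rw [Matrix.mul_add, Matrix.mul_smul]; abel
  have h2 : A * (P + star s • Q) + C = (A * P + C) + star s • (A * Q) := by
    rw [Matrix.mul_add, Matrix.mul_smul]; abel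
  rw [h1, h2, conjTranspose_add, conjTranspose_smul, star_star]
  simp only [Matrix.add_mul, Matrix.mul_add, Matrix.smul_mul, Matrix.mul_smul, smul_add, smul_smul,
    pow_two]
  abel

/-- Independent choices of the two occurrences of `X` in `φ` do not increase the generic rank. -/
theorem exists_rank_phi_ge_of_pair (A : Matrix (Fin n) (Fin p) ℂ) (C : Matrix (Fin n) (Fin m) ℂ)
    (M : Matrix (Fin m) (Fin m) ℂ) (D : Matrix (Fin n) (Fin n) ℂ)
    (Y Z : Matrix (Fin p) (Fin m) ℂ) :
    ∃ X, ((A * Y + C) * M * (A * Z + C)ᴴ + D).rank ≤ (phi A C M D X).rank := by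
  -- Chosen so that `P + iQ = Y` and `P - iQ = Z`. Only finitely many `s` have smaller rank than `s
  -- = i`, so some real `s` does not.
  let P : Matrix (Fin p) (Fin m) ℂ := (2⁻¹ : ℂ) • (Y + Z)
  let Q : Matrix (Fin p) (Fin m) ℂ := (-(Complex.I * 2⁻¹) : ℂ) • (Y - Z)
  have hI : Complex.I * -(Complex.I * 2⁻¹) = 2⁻¹ := by
    rw [mul_neg, ← mul_assoc, Complex.I_mul_I]; ring
  have hY : P + Complex.I • Q = Y := by
    simp only [P, Q, smul_smul, hI]; module
  have hZ : P + star Complex.I • Q = Z := by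
    have : star Complex.I = -Complex.I := Complex.conj_I
    simp only [P, Q, this, smul_smul, neg_mul, hI]; module
  have h := mul_star_add_eq_phi A C M D P Q Complex.I
  rw [hY, hZ] at h
  have hfin := finite_rank_lt _ _ _ (congrArg Matrix.rank h).le
  obtain ⟨s, hs⟩ := (Set.infinite_range_of_injective Complex.ofReal_injective).exists_notMem_finite
    hfin
  obtain ⟨⟨r, rfl⟩, hr⟩ := hs
  refine ⟨P + (r : ℂ) • Q, ?_⟩
  rw [Set.mem_ofPred_eq, not_lt, ← mul_star_add_eq_phi,
    show star (r : ℂ) = r from Complex.conj_ofReal r] at hr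
  exact hr

/-- Two ranks of affine matrix functions can be made large simultaneously. -/
theorem exists_rank_ge_rank_ge {e f : Type*} [Fintype e] [Fintype f]
    [DecidableEq a] [DecidableEq b] [DecidableEq e] [DecidableEq f]
    (A₁ : Matrix a b ℂ) (B₁ : Matrix a c ℂ) (C₁ : Matrix d b ℂ)
    (A₂ : Matrix e f ℂ) (B₂ : Matrix e c ℂ) (C₂ : Matrix d f ℂ) {k : ℕ} (Y₁ Y₂ : Matrix c d ℂ)
    (h₁ : k ≤ (A₁ + B₁ * Y₁ * C₁).rank) (h₂ : k ≤ (A₂ + B₂ * Y₂ * C₂).rank) :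
    ∃ Y : Matrix c d ℂ, k ≤ (A₁ + B₁ * Y * C₁).rank ∧ k ≤ (A₂ + B₂ * Y * C₂).rank := by
  -- On the line from `Y₁` to `Y₂` each rank bound fails for only finitely many `t`.
  have key₁ : ∀ t : ℂ, A₁ + B₁ * (Y₁ + t • (Y₂ - Y₁)) * C₁ =
      (A₁ + B₁ * Y₁ * C₁) + t • (B₁ * (Y₂ - Y₁) * C₁) + t ^ 2 • (0 : Matrix a b ℂ) := by
    intro t
    rw [Matrix.mul_add, Matrix.add_mul, Matrix.mul_smul, Matrix.smul_mul, smul_zero, add_zero,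
      add_assoc]
  have key₂ : ∀ t : ℂ, A₂ + B₂ * (Y₁ + t • (Y₂ - Y₁)) * C₂ =
      (A₂ + B₂ * Y₁ * C₂) + t • (B₂ * (Y₂ - Y₁) * C₂) + t ^ 2 • (0 : Matrix e f ℂ) := by
    intro t
    rw [Matrix.mul_add, Matrix.add_mul, Matrix.mul_smul, Matrix.smul_mul, smul_zero, add_zero,
      add_assoc]
  have h₁' : k ≤ (A₁ + B₁ * (Y₁ + (0 : ℂ) • (Y₂ - Y₁)) * C₁).rank := by simpa using h₁
  have h₂' : k ≤ (A₂ + B₂ * (Y₁ + (1 : ℂ) • (Y₂ - Y₁)) * C₂).rank := by simpa using h₂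
  rw [key₁] at h₁'
  rw [key₂] at h₂'
  obtain ⟨t, -, ht⟩ := (Set.infinite_univ (α := ℂ)).exists_notMem_finite
    ((finite_rank_lt _ _ _ h₁').union (finite_rank_lt _ _ _ h₂'))
  rw [Set.mem_union, not_or, Set.mem_ofPred_eq, Set.mem_ofPred_eq, not_lt, not_lt, ← key₁, ← key₂]
    at ht
  exact ⟨_, ht⟩

theorem rank_add_rank_le_fromBlocks [DecidableEq b] [DecidableEq c] [DecidableEq d] [DecidableEq a]
    (A : Matrix a b ℂ) (B : Matrix a d ℂ) (C : Matrix c d ℂ) :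
    A.rank + C.rank ≤ (fromBlocks A B 0 C).rank := by
  obtain ⟨R, S, h⟩ := exists_mul_mul_eq_one (le_refl A.rank)
  obtain ⟨R', S', h'⟩ := exists_mul_mul_eq_one (le_refl C.rank)
  have key : (fromBlocks R 0 0 R' : Matrix _ (a ⊕ c) ℂ) * fromBlocks A B 0 C *
      (fromBlocks S 0 0 S' : Matrix (b ⊕ d) _ ℂ) = fromBlocks 1 (R * B * S') 0 1 := by
    simp [fromBlocks_multiply, h, h']
  have h1 := (rank_mul_le_left ((fromBlocks R 0 0 R' : Matrix _ (a ⊕ c) ℂ) * fromBlocks A B 0 C)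
    (fromBlocks S 0 0 S' : Matrix (b ⊕ d) _ ℂ)).trans (rank_mul_le_right _ _)
  rw [key, rank_of_isUnit _ ((Matrix.isUnit_iff_isUnit_det _).2 (by simp))] at h1
  simpa using h1

/-- For fixed `Y`, with `P = AY + C`, the decoupled `φ` is `(PMC* + D) + PM Z A*`, affine in `Z`.
Its generic rank is the smaller of the ranks of `[PMC* + D, PM]` and of `PMC* + D` stacked on `A*`.
Up to block operations both are affine in `Y`, and their generic ranks are governed by the three
terms of the minimum. -/
theorem exists_rank_phi_ge (A : Matrix (Fin n) (Fin p) ℂ) (C : Matrix (Fin n) (Fin m) ℂ)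
    {M : Matrix (Fin m) (Fin m) ℂ} (hM : M.IsHermitian) {D : Matrix (Fin n) (Fin n) ℂ}
    (hD : D.IsHermitian) :
    ∃ X, min (fromCols (fromCols A (C * M)) D).rank (min (N₁ A C M D).rank (M.rank + D.rank)) ≤
      (phi A C M D X).rank := by
  set k := min (fromCols (fromCols A (C * M)) D).rank (min (N₁ A C M D).rank (M.rank + D.rank))
    with hk
  have hkρ : k ≤ (fromCols (fromCols A (C * M)) D).rank := min_le_left _ _
  have hkN : k ≤ (N₁ A C M D).rank := (min_le_right _ _).trans (min_le_left _ _)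
  have hkMD : k ≤ M.rank + D.rank := (min_le_right _ _).trans (min_le_right _ _)
  obtain ⟨Y₁, hY₁⟩ := exists_rank_add_mul_mul_ge (fromCols D (C * M)) A
    (fromCols 0 M : Matrix (Fin m) (Fin n ⊕ Fin m) ℂ)
  obtain ⟨Y₂, hY₂⟩ := exists_rank_add_mul_mul_ge (fromRows (D + C * M * Cᴴ) Aᴴ)
    (fromRows A 0 : Matrix (Fin n ⊕ Fin p) (Fin p) ℂ) (M * Cᴴ)
  have h₁ : k ≤ (fromCols D (C * M) + A * Y₁ *
      (fromCols 0 M : Matrix (Fin m) (Fin n ⊕ Fin m) ℂ)).rank := by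
    refine le_trans (le_min ?_ ?_) hY₁
    · refine hkρ.trans ?_
      rw [rank_fromCols_rotate]
    · refine hkMD.trans ?_
      rw [add_comm, fromRows_fromCols_eq_fromBlocks]
      exact rank_add_rank_le_fromBlocks _ _ _
  have h₂ : k ≤ (fromRows (D + C * M * Cᴴ) Aᴴ +
      (fromRows A 0 : Matrix (Fin n ⊕ Fin p) (Fin p) ℂ) * Y₂ * (M * Cᴴ)).rank := by
    refine le_trans (le_min ?_ ?_) hY₂
    · refine hkN.trans_eq ?_
      rw [fromCols_fromRows_eq_fromBlocks]
      rfl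
    · refine hkρ.trans ?_
      rw [rank_fromCols_rotate, ← rank_conjTranspose]
      have h1 : (fromCols (fromCols D (C * M)) A)ᴴ =
          (fromRows (fromRows D Aᴴ) (M * Cᴴ)).submatrix
            (((Equiv.sumAssoc (Fin n) (Fin m) (Fin p)).trans
              ((Equiv.refl _).sumCongr (Equiv.sumComm _ _))).trans (Equiv.sumAssoc _ _ _).symm)
            (Equiv.refl _) := by
        rw [conjTranspose_fromCols_eq_fromRows_conjTranspose,
          conjTranspose_fromCols_eq_fromRows_conjTranspose, conjTranspose_mul, hM.eq, hD.eq]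
        ext ((i | i) | i) j <;> rfl
      have h2 : fromRows (fromRows D Aᴴ) (M * Cᴴ) =
          (fromBlocks 1 (fromRows (-C) 0) 0 1 :
            Matrix ((Fin n ⊕ Fin p) ⊕ Fin m) ((Fin n ⊕ Fin p) ⊕ Fin m) ℂ) *
          fromRows (fromRows (D + C * M * Cᴴ) Aᴴ) (M * Cᴴ) := by
        rw [fromBlocks_mul_fromRows]
        simp [fromRows_mul, fromRows_add_fromRows, Matrix.mul_assoc]
      rw [h1, rank_submatrix, h2]
      exact rank_mul_le_right _ _
  obtain ⟨Y, hY, hY'⟩ := exists_rank_ge_rank_ge _ _ _ _ _ _ Y₁ Y₂ h₁ h₂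
  set P := A * Y + C with hP
  obtain ⟨Z, hZ⟩ := exists_rank_add_mul_mul_ge (P * M * Cᴴ + D) (P * M) Aᴴ
  obtain ⟨X, hX⟩ := exists_rank_phi_ge_of_pair A C M D Y Zᴴ
  refine ⟨X, le_trans (le_trans (le_min ?_ ?_) hZ) (le_of_eq_of_le ?_ hX)⟩
  · refine hY.trans ?_
    rw [show fromCols D (C * M) + A * Y * (fromCols 0 M : Matrix (Fin m) (Fin n ⊕ Fin m) ℂ) =
        fromCols (P * M * Cᴴ + D) (P * M) *
          (fromBlocks 1 0 (-Cᴴ) 1 : Matrix (Fin n ⊕ Fin m) (Fin n ⊕ Fin m) ℂ) by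
      rw [fromCols_mul_fromBlocks]
      simp [mul_fromCols, fromCols_add_fromCols, hP, Matrix.add_mul, Matrix.mul_assoc]
      congr 1 <;> abel]
    exact rank_mul_le_left _ _
  · refine hY'.trans_eq ?_
    congr 1
    simp only [fromRows_mul, fromRows_add_fromRows, hP, Matrix.add_mul, Matrix.mul_assoc,
      Matrix.zero_mul, add_zero]
    congr 1
    abel
  · congr 1
    simp [Matrix.mul_add, Matrix.mul_assoc, hP]
    abel

end Rank

end QuadInertia

namespace QuadInertia

open Module Submodule

/-! ### The index as a count of eigenvalues. -/

section Index

variable {W W' : Type*} [NormedAddCommGroup W] [InnerProductSpace ℂ W]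

theorem quad_eq_sum {ι : Type*} [Fintype ι] (b : OrthonormalBasis ι ℂ W) {T : W →ₗ[ℂ] W}
    (hT : T.IsSymmetric) {μ : ι → ℝ} (h : ∀ i, T (b i) = (μ i : ℂ) • b i) (x : W) :
    quad T x = ∑ i, μ i * ‖inner ℂ (b i) x‖ ^ 2 := by
  rw [quad, ← b.sum_inner_mul_inner, Complex.re_sum]
  refine Finset.sum_congr rfl fun i _ => ?_
  rw [hT, h, inner_smul_right, mul_assoc, Complex.re_ofReal_mul, ← inner_conj_symm x,
    ← Complex.normSq_eq_conj_mul_self, Complex.ofReal_re, Complex.normSq_eq_norm_sq]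

variable [FiniteDimensional ℂ W] [NormedAddCommGroup W'] [InnerProductSpace ℂ W']
  [FiniteDimensional ℂ W']

/-- `L` need not be injective: the form vanishes on `S ⊓ ker L`, so a positive subspace embeds, and
conversely one lifts to a complement of that kernel. -/
theorem idx_map {T : W →ₗ[ℂ] W} {T' : W' →ₗ[ℂ] W'} {S : Submodule ℂ W'} (L : W' →ₗ[ℂ] W)
    (h : ∀ x ∈ S, quad T' x = quad T (L x)) : idx T' S = idx T (S.map L) := by
  apply le_antisymm
  · obtain ⟨P, hP, hpos, hr⟩ := exists_idx T' S
    have hinj : Function.Injective (L.domRestrict P) := by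
      rw [← LinearMap.ker_eq_bot, LinearMap.ker_eq_bot']
      rintro ⟨x, hx⟩ hx0
      by_contra hne
      have h1 := hpos x hx (by simpa using hne)
      rw [h x (hP hx), show L x = 0 from hx0, quad_zero] at h1
      exact lt_irrefl _ h1
    have h2 := LinearMap.finrank_range_of_inj hinj
    rw [LinearMap.range_domRestrict] at h2
    rw [← hr, ← h2]
    refine le_idx (Submodule.map_mono hP) ?_
    rintro _ ⟨x, hx, rfl⟩ hne
    rw [← h x (hP hx)]
    exact hpos x hx (by rintro rfl; exact hne (map_zero L))
  · obtain ⟨P, hP, hpos, hr⟩ := exists_idx T (S.map L)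
    obtain ⟨K, hK⟩ := Submodule.exists_isCompl (S ⊓ LinearMap.ker L)
    have hpos' : PosOn T' (S ⊓ P.comap L ⊓ K) := by
      rintro x ⟨⟨hxS, hxP⟩, hxK⟩ hne
      rw [h x hxS]
      exact hpos _ hxP fun h0 => hne (Submodule.disjoint_def.1 hK.disjoint x ⟨hxS, h0⟩ hxK)
    have hmap : P ≤ (S ⊓ P.comap L ⊓ K).map L := by
      intro y hy
      obtain ⟨x, hx, rfl⟩ := hP hy
      obtain ⟨z, hz, w, hw, rfl⟩ := Submodule.mem_sup.1
        (show x ∈ S ⊓ LinearMap.ker L ⊔ K by rw [hK.sup_eq_top]; trivial)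
      have hLz : L z = 0 := hz.2
      refine ⟨w, ⟨⟨(S.add_mem_iff_right hz.1).1 hx, ?_⟩, hw⟩, by simp [hLz]⟩
      simpa [hLz] using hy
    have h1 := Submodule.finrank_mono hmap
    have h2 := Submodule.finrank_map_le L (S ⊓ P.comap L ⊓ K)
    have h3 := le_idx (inf_le_left.trans inf_le_left : S ⊓ P.comap L ⊓ K ≤ S) hpos'
    omega

theorem idx_sup_of_orth {T : W →ₗ[ℂ] W} (hT : T.IsSymmetric) {A B : Submodule ℂ W}
    (h : B ≤ orth T A) : idx T (A ⊔ B) = idx T A + idx T B := by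
  obtain ⟨P, hP, hpos, hr⟩ := exists_idx T A
  obtain ⟨Q, hQ, hpos', hr'⟩ := exists_idx T B
  have hQP : Q ≤ orth T P := hQ.trans (h.trans (orth_anti T hP))
  have hsum := hpos.sup hT hpos' hQP
  have hdim := Submodule.finrank_sup_add_finrank_inf_eq P Q
  have hbot : P ⊓ Q = ⊥ := eq_bot_iff.2 ((inf_le_inf_left P hQP).trans hpos.inf_orth.le)
  rw [hbot, finrank_bot] at hdim
  have h1 := le_idx (sup_le_sup hP hQ) hsum
  have h2 : idx T (A ⊔ B) ≤ finrank ℂ (P ⊔ Q : Submodule ℂ W) := by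
    apply idx_le_of_le_sup (K := A ⊓ orth T P ⊔ B ⊓ orth T Q)
    · intro x hx
      obtain ⟨y, hy, z, hz, rfl⟩ := Submodule.mem_sup.1 hx
      rw [quad_add_of_orth hT (mem_orth.1 (h hz.1) y hy.1)]
      exact add_nonpos (quad_nonpos_of_maximal hT hP hpos hr y hy)
        (quad_nonpos_of_maximal hT hQ hpos' hr' z hz)
    · rw [sup_sup_sup_comm, hpos.sup_inf_orth hP, hpos'.sup_inf_orth hQ]
  omega

/-- The eigenvectors with positive eigenvalue span a positive subspace, the others a nonpositive
one, and together they span everything. -/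
theorem idx_top_eq_card {ι : Type*} [Fintype ι] [DecidableEq ι] (b : OrthonormalBasis ι ℂ W)
    {T : W →ₗ[ℂ] W} (hT : T.IsSymmetric) {μ : ι → ℝ} (h : ∀ i, T (b i) = (μ i : ℂ) • b i) :
    idx T ⊤ = (Finset.univ.filter fun i => 0 < μ i).card := by
  have hzero : ∀ s : Set ι, ∀ x ∈ span ℂ (b '' s), ∀ i ∉ s, inner ℂ (b i) x = 0 := by
    intro s x hx i hi
    induction hx using Submodule.span_induction with
    | mem x hx =>
      obtain ⟨j, hj, rfl⟩ := hx
      rw [b.inner_eq_ite, if_neg (by rintro rfl; exact hi hj)]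
    | zero => exact inner_zero_right _
    | add x y _ _ hx hy => rw [inner_add_right, hx, hy, add_zero]
    | smul c x _ hx => rw [inner_smul_right, hx, mul_zero]
  have hcard : finrank ℂ (span ℂ (b '' {i | 0 < μ i})) =
      (Finset.univ.filter fun i => 0 < μ i).card := by
    rw [Set.image_eq_range]
    exact (finrank_span_eq_card
      (b.orthonormal.linearIndependent.comp (fun i : {i | 0 < μ i} => (i : ι))
        Subtype.val_injective)).trans (Fintype.card_subtype _)
  apply le_antisymm
  · rw [← hcard]
    apply idx_le_of_le_sup (K := span ℂ (b '' {i | 0 < μ i}ᶜ))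
    · intro x hx
      rw [quad_eq_sum b hT h]
      refine Finset.sum_nonpos fun i _ => ?_
      by_cases hi : 0 < μ i
      · simp [hzero _ x hx i (by simpa using hi)]
      · exact mul_nonpos_of_nonpos_of_nonneg (not_lt.1 hi) (by positivity)
    · rw [← Submodule.span_union, ← Set.image_union, Set.union_compl_self, Set.image_univ]
      have := b.toBasis.span_eq
      rw [b.coe_toBasis] at this
      exact this.ge
  · rw [← hcard]
    refine le_idx le_top fun x hx hne => ?_
    rw [quad_eq_sum b hT h]
    have hnn : ∀ i, 0 ≤ μ i * ‖inner ℂ (b i) x‖ ^ 2 := by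
      intro i
      by_cases hi : 0 < μ i
      · positivity
      · simp [hzero _ x hx i hi]
    obtain ⟨i, hi⟩ : ∃ i, inner ℂ (b i) x ≠ 0 := by
      by_contra! hcon
      refine hne (b.repr.injective ?_)
      ext i
      rw [b.repr_apply_apply, hcon i, map_zero]
      rfl
    refine Finset.sum_pos' (fun i _ => hnn i) ⟨i, Finset.mem_univ i, ?_⟩
    have hμ : 0 < μ i := by
      by_contra hμ
      exact hi (hzero _ x hx i hμ)
    positivity

variable {a b : Type*} [Fintype a] [Fintype b] [DecidableEq b]

theorem finrank_ker_toEuclideanLin (B : Matrix a b ℂ) :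
    B.rank + finrank ℂ (LinearMap.ker (toEuclideanLin B)) = Fintype.card b := by
  have h := LinearMap.finrank_range_add_finrank_ker (toEuclideanLin B)
  rw [finrank_euclideanSpace] at h
  rw [← h, toEuclideanLin_eq_toLin_orthonormal, ← Matrix.rank_eq_finrank_range_toLin]

variable [DecidableEq a]

theorem isSymmetric_toEuclideanLin {S : Matrix a a ℂ} (hS : S.IsHermitian) :
    (toEuclideanLin S).IsSymmetric := isSymmetric_toEuclideanLin_iff.2 hS

theorem toEuclideanLin_eigenvectorBasis {S : Matrix a a ℂ} (hS : S.IsHermitian) (i : a) :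
    toEuclideanLin S (hS.eigenvectorBasis i) =
      (hS.eigenvalues i : ℂ) • hS.eigenvectorBasis i := by
  have := hS.mulVec_eigenvectorBasis i
  ext j
  rw [ofLp_toLpLin, toLin'_apply, this]
  rfl

theorem posInertia_eq_idx {S : Matrix a a ℂ} (hS : S.IsHermitian) :
    posInertia S = idx (toEuclideanLin S) ⊤ := by
  rw [posInertia_eq hS, idx_top_eq_card hS.eigenvectorBasis (isSymmetric_toEuclideanLin hS)
    (toEuclideanLin_eigenvectorBasis hS)]

theorem negInertia_eq_idx {S : Matrix a a ℂ} (hS : S.IsHermitian) :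
    negInertia S = idx (-toEuclideanLin S) ⊤ := by
  rw [negInertia_eq hS, idx_top_eq_card (μ := fun i => -hS.eigenvalues i) hS.eigenvectorBasis
    (isSymmetric_neg (isSymmetric_toEuclideanLin hS))]
  · simp
  · intro i
    rw [LinearMap.neg_apply, toEuclideanLin_eigenvectorBasis hS]
    simp

theorem rank_eq_posInertia_add_negInertia {S : Matrix a a ℂ} (hS : S.IsHermitian) :
    S.rank = posInertia S + negInertia S := by
  have h1 := finrank_eq_idx_add_idx (isSymmetric_toEuclideanLin hS) ⊤
  rw [orth_top (isSymmetric_toEuclideanLin hS), top_inf_eq, finrank_top,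
    finrank_euclideanSpace] at h1
  have h2 := finrank_ker_toEuclideanLin S
  rw [posInertia_eq_idx hS, negInertia_eq_idx hS]
  omega

theorem inner_toEuclideanLin_left (B : Matrix a b ℂ) (x : EuclideanSpace ℂ b)
    (y : EuclideanSpace ℂ a) :
    inner ℂ (toEuclideanLin B x) y = inner ℂ x (toEuclideanLin Bᴴ y) := by
  rw [Matrix.toEuclideanLin_conjTranspose_eq_adjoint, LinearMap.adjoint_inner_right]

end Index

end QuadInertia

namespace QuadInertia

open Module Submodule

/-! ### Graphs as complements of the vertical subspace. -/

section Graph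

theorem prod_ext {α β : Type*} {w w' : WithLp 2 (α × β)} (h : w.fst = w'.fst)
    (h' : w.snd = w'.snd) : w = w' :=
  (WithLp.equiv 2 (α × β)).injective (Prod.ext h h')

variable {E E' : Type*} [NormedAddCommGroup E] [InnerProductSpace ℂ E]
  [NormedAddCommGroup E'] [InnerProductSpace ℂ E']

/-- The graph embedding `u ↦ (u, R u)`. -/
noncomputable def graphMap (R : E →ₗ[ℂ] E') : E →ₗ[ℂ] WithLp 2 (E × E') :=
  (WithLp.linearEquiv 2 ℂ (E × E')).symm.toLinearMap ∘ₗ LinearMap.prod LinearMap.id R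

/-- The projection of `E × E'` onto `E`. -/
noncomputable def fstMap (E E' : Type*) [NormedAddCommGroup E] [InnerProductSpace ℂ E]
    [NormedAddCommGroup E'] [InnerProductSpace ℂ E'] : WithLp 2 (E × E') →ₗ[ℂ] E :=
  LinearMap.fst ℂ E E' ∘ₗ (WithLp.linearEquiv 2 ℂ (E × E')).toLinearMap

/-- The embedding `v ↦ (0, v)`. -/
noncomputable def inrMap (E E' : Type*) [NormedAddCommGroup E] [InnerProductSpace ℂ E]
    [NormedAddCommGroup E'] [InnerProductSpace ℂ E'] : E' →ₗ[ℂ] WithLp 2 (E × E') :=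
  (WithLp.linearEquiv 2 ℂ (E × E')).symm.toLinearMap ∘ₗ LinearMap.inr ℂ E E'

/-- The direct sum of two operators. -/
noncomputable def sumMap (S : E →ₗ[ℂ] E) (S' : E' →ₗ[ℂ] E') :
    WithLp 2 (E × E') →ₗ[ℂ] WithLp 2 (E × E') :=
  (WithLp.linearEquiv 2 ℂ (E × E')).symm.toLinearMap ∘ₗ LinearMap.prodMap S S' ∘ₗ
    (WithLp.linearEquiv 2 ℂ (E × E')).toLinearMap

@[simp] theorem graphMap_fst (R : E →ₗ[ℂ] E') (u : E) : (graphMap R u).fst = u := rfl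
@[simp] theorem graphMap_snd (R : E →ₗ[ℂ] E') (u : E) : (graphMap R u).snd = R u := rfl
@[simp] theorem fstMap_apply (w : WithLp 2 (E × E')) : fstMap E E' w = w.fst := rfl
@[simp] theorem inrMap_fst (v : E') : (inrMap E E' v).fst = 0 := rfl
@[simp] theorem inrMap_snd (v : E') : (inrMap E E' v).snd = v := rfl
@[simp] theorem sumMap_fst (S : E →ₗ[ℂ] E) (S' : E' →ₗ[ℂ] E') (w : WithLp 2 (E × E')) :
    (sumMap S S' w).fst = S w.fst := rfl
@[simp] theorem sumMap_snd (S : E →ₗ[ℂ] E) (S' : E' →ₗ[ℂ] E') (w : WithLp 2 (E × E')) :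
    (sumMap S S' w).snd = S' w.snd := rfl

theorem graphMap_injective (R : E →ₗ[ℂ] E') : Function.Injective (graphMap R) :=
  fun _ _ h => congrArg (fun w => w.fst) h

theorem inrMap_injective : Function.Injective (inrMap E E') :=
  fun _ _ h => congrArg (fun w => w.snd) h

theorem ker_fstMap : LinearMap.ker (fstMap E E') = LinearMap.range (inrMap E E') := by
  ext w
  rw [LinearMap.mem_ker, fstMap_apply]
  constructor
  · exact fun h => ⟨w.snd, prod_ext (by simp [h]) (by simp)⟩
  · rintro ⟨v, rfl⟩; simp

theorem isSymmetric_sumMap {S : E →ₗ[ℂ] E} {S' : E' →ₗ[ℂ] E'} (hS : S.IsSymmetric)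
    (hS' : S'.IsSymmetric) : (sumMap S S').IsSymmetric := fun x y => by
  simp [WithLp.prod_inner_apply, hS _ _, hS' _ _]

theorem neg_sumMap (S : E →ₗ[ℂ] E) (S' : E' →ₗ[ℂ] E') : -sumMap S S' = sumMap (-S) (-S') := by
  ext w
  exact prod_ext rfl rfl

theorem quad_sumMap (S : E →ₗ[ℂ] E) (S' : E' →ₗ[ℂ] E') (w : WithLp 2 (E × E')) :
    quad (sumMap S S') w = quad S w.fst + quad S' w.snd := by
  simp [quad, WithLp.prod_inner_apply]

theorem isCompl_range_graphMap (R : E →ₗ[ℂ] E') :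
    IsCompl (LinearMap.range (graphMap R)) (LinearMap.ker (fstMap E E')) := by
  constructor
  · rw [Submodule.disjoint_def]
    rintro _ ⟨u, rfl⟩ h
    have h1 : u = 0 := h
    rw [h1, map_zero]
  · rw [codisjoint_iff, eq_top_iff]
    intro w _
    have h1 : w = graphMap R w.fst + (w - graphMap R w.fst) := by abel
    rw [h1]
    refine Submodule.add_mem_sup ⟨_, rfl⟩ ?_
    simp

variable [FiniteDimensional ℂ E] [FiniteDimensional ℂ E']

theorem exists_comp_eq_of_ker_le {E₁ E₂ E₃ : Type*} [AddCommGroup E₁] [Module ℂ E₁]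
    [AddCommGroup E₂] [Module ℂ E₂] [AddCommGroup E₃] [Module ℂ E₃] {f : E₁ →ₗ[ℂ] E₂}
    {g : E₁ →ₗ[ℂ] E₃} (h : LinearMap.ker f ≤ LinearMap.ker g) : ∃ k : E₂ →ₗ[ℂ] E₃, k ∘ₗ f = g := by
  obtain ⟨s, hs⟩ := f.rangeRestrict.exists_rightInverse_of_surjective f.range_rangeRestrict
  obtain ⟨k, hk⟩ := LinearMap.exists_extend (g ∘ₗ s)
  refine ⟨k, LinearMap.ext fun x => ?_⟩
  have h1 : k (f x) = g (s (f.rangeRestrict x)) := LinearMap.congr_fun hk (f.rangeRestrict x)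
  have h2 : f (s (f.rangeRestrict x)) = f x :=
    congrArg Subtype.val (LinearMap.congr_fun hs (f.rangeRestrict x))
  rw [LinearMap.comp_apply, h1, ← sub_eq_zero, ← map_sub]
  exact h (by rw [LinearMap.mem_ker, map_sub, h2, sub_self])

/-- The first projection is onto from `V`; a section of it followed by the second projection is `R`,
and dimensions give equality. -/
theorem exists_range_graphMap_eq {V : Submodule ℂ (WithLp 2 (E × E'))}
    (hV : IsCompl V (LinearMap.ker (fstMap E E'))) :
    ∃ R : E →ₗ[ℂ] E', LinearMap.range (graphMap R) = V := by
  have hsurj : LinearMap.range ((fstMap E E').domRestrict V) = ⊤ := by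
    rw [LinearMap.range_domRestrict, eq_top_iff]
    intro u _
    obtain ⟨v, hv, g, hg, h⟩ := Submodule.mem_sup.1
      (show graphMap (0 : E →ₗ[ℂ] E') u ∈ V ⊔ LinearMap.ker (fstMap E E') by
        rw [hV.sup_eq_top]; trivial)
    refine ⟨v, hv, ?_⟩
    have h1 := congrArg (fstMap E E') h
    rw [map_add, LinearMap.mem_ker.1 hg, add_zero] at h1
    exact h1
  obtain ⟨s, hs⟩ := LinearMap.exists_rightInverse_of_surjective _ hsurj
  let snd : WithLp 2 (E × E') →ₗ[ℂ] E' :=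
    LinearMap.snd ℂ E E' ∘ₗ (WithLp.linearEquiv 2 ℂ (E × E')).toLinearMap
  have hgr : ∀ u, graphMap (snd ∘ₗ V.subtype ∘ₗ s) u = s u := fun u =>
    prod_ext (LinearMap.congr_fun hs u).symm rfl
  refine ⟨snd ∘ₗ V.subtype ∘ₗ s, Submodule.eq_of_le_of_finrank_eq ?_ ?_⟩
  · rintro _ ⟨u, rfl⟩
    rw [hgr]
    exact (s u).2
  · have h1 := Submodule.finrank_add_eq_of_isCompl hV
    have h2 := Submodule.finrank_add_eq_of_isCompl
      (isCompl_range_graphMap (snd ∘ₗ V.subtype ∘ₗ s))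
    omega

theorem idx_sumMap_top {S : E →ₗ[ℂ] E} {S' : E' →ₗ[ℂ] E'} (hS : S.IsSymmetric)
    (hS' : S'.IsSymmetric) : idx (sumMap S S') ⊤ = idx S ⊤ + idx S' ⊤ := by
  rw [idx_map (T := sumMap S S') (graphMap (0 : E →ₗ[ℂ] E'))
      (fun x _ => by simp [quad_sumMap] : ∀ x ∈ ⊤, quad S x = _),
    idx_map (T := sumMap S S') (inrMap E E')
      (fun x _ => by simp [quad_sumMap] : ∀ x ∈ ⊤, quad S' x = _),
    ← idx_sup_of_orth (isSymmetric_sumMap hS hS'), Submodule.map_top, Submodule.map_top,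
    ← ker_fstMap, (isCompl_range_graphMap _).sup_eq_top]
  rintro _ ⟨v, -, rfl⟩
  rw [mem_orth]
  rintro _ ⟨u, -, rfl⟩
  simp [WithLp.prod_inner_apply]

end Graph

end QuadInertia

namespace QuadInertia

open Module Submodule
open scoped ComplexOrder

/-! ### Translation between `φ` and the graphs of `(AX + C)*`. -/

section Matrices

theorem finrank_map_of_injective {E E' : Type*} [AddCommGroup E] [Module ℂ E] [AddCommGroup E']
    [Module ℂ E'] {f : E →ₗ[ℂ] E'} (hf : Function.Injective f) (S : Submodule ℂ E) :
    finrank ℂ (S.map f) = finrank ℂ S :=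
  (Submodule.equivMapOfInjective f hf S).finrank_eq.symm

theorem ker_toEuclideanLin_fromRows {a b c : Type*} [Fintype c] [DecidableEq c] (A : Matrix a c ℂ)
    (B : Matrix b c ℂ) :
    LinearMap.ker (toEuclideanLin (fromRows A B)) =
      LinearMap.ker (toEuclideanLin A) ⊓ LinearMap.ker (toEuclideanLin B) := by
  ext x
  simp only [Submodule.mem_inf, LinearMap.mem_ker, toLpLin_apply, WithLp.toLp_eq_zero,
    fromRows_mulVec]
  constructor
  · exact fun h => ⟨funext fun i => congrFun h (Sum.inl i), funext fun i => congrFun h (Sum.inr i)⟩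
  · rintro ⟨h, h'⟩
    rw [h, h']
    ext (i | i) <;> rfl

theorem rank_add_finrank_ker_conjTranspose {a b : Type*} [Fintype a] [Fintype b] [DecidableEq a]
    (B : Matrix a b ℂ) :
    B.rank + finrank ℂ (LinearMap.ker (toEuclideanLin Bᴴ)) = Fintype.card a := by
  rw [← rank_conjTranspose, finrank_ker_toEuclideanLin]

theorem toEuclideanLin_mul_apply {a b c : Type*} [Fintype b] [Fintype c] [DecidableEq b]
    [DecidableEq c] (A : Matrix a b ℂ) (B : Matrix b c ℂ) (x : EuclideanSpace ℂ c) :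
    toEuclideanLin (A * B) x = toEuclideanLin A (toEuclideanLin B x) := by
  simp [toLpLin_apply]

theorem orthogonal_ker_conjTranspose {a b : Type*} [Fintype a] [Fintype b] [DecidableEq a]
    [DecidableEq b] (A : Matrix a b ℂ) :
    (LinearMap.ker (toEuclideanLin Aᴴ))ᗮ = LinearMap.range (toEuclideanLin A) := by
  have h : (LinearMap.range (toEuclideanLin A))ᗮ = LinearMap.ker (toEuclideanLin Aᴴ) := by
    ext x
    rw [Submodule.mem_orthogonal, LinearMap.mem_ker]
    constructor
    · intro h
      have := h _ ⟨toEuclideanLin Aᴴ x, rfl⟩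
      rwa [inner_toEuclideanLin_left, inner_self_eq_zero] at this
    · rintro h _ ⟨y, rfl⟩
      rw [inner_toEuclideanLin_left, h, inner_zero_right]
  rw [← h, Submodule.orthogonal_orthogonal]

variable {n p m : ℕ} (A : Matrix (Fin n) (Fin p) ℂ) (C : Matrix (Fin n) (Fin m) ℂ)
  (M : Matrix (Fin m) (Fin m) ℂ) (D : Matrix (Fin n) (Fin n) ℂ)

/-- The subspace `{(u, C* u) : A* u = 0}`, contained in the graph of `(AX + C)*` for all `X`. -/
noncomputable def fixedSpace :
    Submodule ℂ (WithLp 2 (EuclideanSpace ℂ (Fin n) × EuclideanSpace ℂ (Fin m))) :=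
  (LinearMap.ker (toEuclideanLin Aᴴ)).map (graphMap (toEuclideanLin Cᴴ))

/-- The operator `D ⊕ M`. -/
noncomputable def sumOp :
    WithLp 2 (EuclideanSpace ℂ (Fin n) × EuclideanSpace ℂ (Fin m)) →ₗ[ℂ]
      WithLp 2 (EuclideanSpace ℂ (Fin n) × EuclideanSpace ℂ (Fin m)) :=
  sumMap (toEuclideanLin D) (toEuclideanLin M)

/-- The graph of `(AX + C)*`. -/
noncomputable def graphSpace (X : Matrix (Fin p) (Fin m) ℂ) :
    Submodule ℂ (WithLp 2 (EuclideanSpace ℂ (Fin n) × EuclideanSpace ℂ (Fin m))) :=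
  LinearMap.range (graphMap (toEuclideanLin (A * X + C)ᴴ))

/-- The subspace `{(0, v)}`. -/
noncomputable def vertSpace (n m : ℕ) :
    Submodule ℂ (WithLp 2 (EuclideanSpace ℂ (Fin n) × EuclideanSpace ℂ (Fin m))) :=
  LinearMap.ker (fstMap (EuclideanSpace ℂ (Fin n)) (EuclideanSpace ℂ (Fin m)))

theorem isCompl_graphSpace (X : Matrix (Fin p) (Fin m) ℂ) :
    IsCompl (graphSpace A C X) (vertSpace n m) := isCompl_range_graphMap _

theorem fixedSpace_le_graphSpace (X : Matrix (Fin p) (Fin m) ℂ) :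
    fixedSpace A C ≤ graphSpace A C X := by
  rintro _ ⟨u, hu, rfl⟩
  refine ⟨u, prod_ext rfl ?_⟩
  have hu' : toEuclideanLin Aᴴ u = 0 := hu
  simp only [graphMap_snd, conjTranspose_add, conjTranspose_mul, map_add, LinearMap.add_apply,
    toEuclideanLin_mul_apply, hu', map_zero, zero_add]

theorem disjoint_fixedSpace : Disjoint (fixedSpace A C) (vertSpace n m) :=
  (isCompl_graphSpace A C 0).disjoint.mono_left (fixedSpace_le_graphSpace A C 0)

theorem exists_graphSpace_eq {V : Submodule ℂ
    (WithLp 2 (EuclideanSpace ℂ (Fin n) × EuclideanSpace ℂ (Fin m)))}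
    (hFV : fixedSpace A C ≤ V) (hV : IsCompl V (vertSpace n m)) :
    ∃ X : Matrix (Fin p) (Fin m) ℂ, graphSpace A C X = V := by
  obtain ⟨R, rfl⟩ := exists_range_graphMap_eq hV
  -- Containing `fixedSpace` forces `R = C*` on `ker A*`, so `R - C*` factors as `Y A*`, and `X =
  -- Y*`.
  have hker : LinearMap.ker (toEuclideanLin Aᴴ) ≤ LinearMap.ker (R - toEuclideanLin Cᴴ) := by
    intro u hu
    obtain ⟨u', hu'⟩ := hFV ⟨u, hu, rfl⟩
    have h1 : u' = u := congrArg (fun w => w.fst) hu'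
    have h2 : R u' = toEuclideanLin Cᴴ u := congrArg (fun w => w.snd) hu'
    rw [LinearMap.mem_ker, LinearMap.sub_apply, ← h2, h1, sub_self]
  obtain ⟨k, hk⟩ := exists_comp_eq_of_ker_le hker
  obtain ⟨Y, rfl⟩ := (toEuclideanLin (𝕜 := ℂ) (m := Fin m) (n := Fin p)).surjective k
  refine ⟨Yᴴ, ?_⟩
  have h : toEuclideanLin (A * Yᴴ + C)ᴴ = R := by
    refine LinearMap.ext fun u => ?_
    have h1 := LinearMap.congr_fun hk u
    simp only [LinearMap.comp_apply, LinearMap.sub_apply] at h1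
    simp only [conjTranspose_add, conjTranspose_mul, conjTranspose_conjTranspose, map_add,
      LinearMap.add_apply, toEuclideanLin_mul_apply, h1, sub_add_cancel]
  rw [graphSpace, h]

variable {M D}

theorem isHermitian_mul_mul_add (hM : M.IsHermitian) (hD : D.IsHermitian)
    (B : Matrix (Fin n) (Fin m) ℂ) : (B * M * Bᴴ + D).IsHermitian :=
  (isHermitian_mul_mul_conjTranspose B hM).add hD

variable (M D)

theorem quad_mul_mul_add (B : Matrix (Fin n) (Fin m) ℂ) (u : EuclideanSpace ℂ (Fin n)) :
    quad (toEuclideanLin (B * M * Bᴴ + D)) u =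
      quad (sumOp M D) (graphMap (toEuclideanLin Bᴴ) u) := by
  rw [sumOp, quad_sumMap, add_comm]
  simp only [quad, map_add, LinearMap.add_apply, inner_add_left, Complex.add_re,
    toEuclideanLin_mul_apply, graphMap_fst, graphMap_snd]
  rw [inner_toEuclideanLin_left B]

variable {M D}

theorem isSymmetric_sumOp (hM : M.IsHermitian) (hD : D.IsHermitian) : (sumOp M D).IsSymmetric :=
  isSymmetric_sumMap (isSymmetric_toEuclideanLin hD) (isSymmetric_toEuclideanLin hM)

theorem posInertia_phi (hM : M.IsHermitian) (hD : D.IsHermitian) (X : Matrix (Fin p) (Fin m) ℂ) :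
    posInertia (phi A C M D X) = idx (sumOp M D) (graphSpace A C X) := by
  rw [phi, posInertia_eq_idx (isHermitian_mul_mul_add hM hD _), graphSpace, LinearMap.range_eq_map]
  exact idx_map _ fun u _ => quad_mul_mul_add M D _ u

theorem negInertia_phi (hM : M.IsHermitian) (hD : D.IsHermitian) (X : Matrix (Fin p) (Fin m) ℂ) :
    negInertia (phi A C M D X) = idx (-sumOp M D) (graphSpace A C X) := by
  rw [phi, negInertia_eq_idx (isHermitian_mul_mul_add hM hD _), graphSpace, LinearMap.range_eq_map]
  exact idx_map _ fun u _ => by rw [quad_neg, quad_neg, quad_mul_mul_add M D _ u]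

theorem idx_sumOp_top (hM : M.IsHermitian) (hD : D.IsHermitian) :
    idx (sumOp M D) ⊤ = posInertia M + posInertia D := by
  rw [sumOp, idx_sumMap_top (isSymmetric_toEuclideanLin hD) (isSymmetric_toEuclideanLin hM),
    posInertia_eq_idx hM, posInertia_eq_idx hD, add_comm]

theorem idx_neg_sumOp_top (hM : M.IsHermitian) (hD : D.IsHermitian) :
    idx (-sumOp M D) ⊤ = negInertia M + negInertia D := by
  rw [sumOp, neg_sumMap, idx_sumMap_top (isSymmetric_neg (isSymmetric_toEuclideanLin hD))
    (isSymmetric_neg (isSymmetric_toEuclideanLin hM)), negInertia_eq_idx hM, negInertia_eq_idx hD,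
    add_comm]

theorem finrank_vertSpace : finrank ℂ (vertSpace n m) = m := by
  rw [vertSpace, ker_fstMap, LinearMap.finrank_range_of_inj inrMap_injective,
    finrank_euclideanSpace_fin]

theorem finrank_graphSpace (X : Matrix (Fin p) (Fin m) ℂ) : finrank ℂ (graphSpace A C X) = n := by
  rw [graphSpace, LinearMap.finrank_range_of_inj (graphMap_injective _), finrank_euclideanSpace_fin]

theorem finrank_fixedSpace : A.rank + finrank ℂ (fixedSpace A C) = n := by
  rw [fixedSpace, finrank_map_of_injective (graphMap_injective _),
    rank_add_finrank_ker_conjTranspose, Fintype.card_fin]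

theorem finrank_withLp : finrank ℂ (WithLp 2 (EuclideanSpace ℂ (Fin n) ×
    EuclideanSpace ℂ (Fin m))) = n + m := by
  rw [← Submodule.finrank_add_eq_of_isCompl
    (isCompl_graphSpace (0 : Matrix (Fin n) (Fin 0) ℂ) (0 : Matrix (Fin n) (Fin m) ℂ) 0),
    finrank_graphSpace, finrank_vertSpace]

theorem mem_ker_sumOp {w : WithLp 2 (EuclideanSpace ℂ (Fin n) × EuclideanSpace ℂ (Fin m))} :
    w ∈ LinearMap.ker (sumOp M D) ↔ toEuclideanLin D w.fst = 0 ∧ toEuclideanLin M w.snd = 0 := by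
  rw [LinearMap.mem_ker]
  exact ⟨fun h => ⟨congrArg (fun w => w.fst) h, congrArg (fun w => w.snd) h⟩,
    fun h => prod_ext h.1 h.2⟩

theorem finrank_ker_sumOp (hM : M.IsHermitian) (hD : D.IsHermitian) :
    finrank ℂ (LinearMap.ker (sumOp M D)) =
      finrank ℂ (LinearMap.ker (toEuclideanLin D)) +
        finrank ℂ (LinearMap.ker (toEuclideanLin M)) := by
  have h1 := finrank_eq_idx_add_idx (isSymmetric_sumOp hM hD) ⊤
  rw [orth_top (isSymmetric_sumOp hM hD), top_inf_eq, finrank_top, finrank_withLp,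
    idx_sumOp_top hM hD, idx_neg_sumOp_top hM hD] at h1
  have h2 := finrank_ker_toEuclideanLin D
  have h3 := finrank_ker_toEuclideanLin M
  rw [rank_eq_posInertia_add_negInertia hD, Fintype.card_fin] at h2
  rw [rank_eq_posInertia_add_negInertia hM, Fintype.card_fin] at h3
  omega

/-- The kernel of `[A, CM, D]*` is carried by `u ↦ (u, C* u)` onto `fixedSpace ⊓ ker (D ⊕ M)`. -/
theorem rank_fromCols_add_finrank (hM : M.IsHermitian) (hD : D.IsHermitian) :
    (fromCols (fromCols A (C * M)) D).rank +
      finrank ℂ (fixedSpace A C ⊓ LinearMap.ker (sumOp M D) : Submodule ℂ _) = n := by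
  have h := rank_add_finrank_ker_conjTranspose (fromCols (fromCols A (C * M)) D)
  rw [conjTranspose_fromCols_eq_fromRows_conjTranspose,
    conjTranspose_fromCols_eq_fromRows_conjTranspose, ker_toEuclideanLin_fromRows,
    ker_toEuclideanLin_fromRows, conjTranspose_mul, hM.eq, hD.eq, Fintype.card_fin] at h
  rw [← finrank_map_of_injective (graphMap_injective (toEuclideanLin Cᴴ))] at h
  have e : fixedSpace A C ⊓ LinearMap.ker (sumOp M D) =
      (LinearMap.ker (toEuclideanLin Aᴴ) ⊓ LinearMap.ker (toEuclideanLin (M * Cᴴ)) ⊓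
        LinearMap.ker (toEuclideanLin D)).map (graphMap (toEuclideanLin Cᴴ)) := by
    ext w
    constructor
    · rintro ⟨⟨u, hu, rfl⟩, hw⟩
      rw [SetLike.mem_coe, mem_ker_sumOp] at hw
      refine ⟨u, ⟨⟨hu, ?_⟩, hw.1⟩, rfl⟩
      rw [SetLike.mem_coe, LinearMap.mem_ker, toEuclideanLin_mul_apply]
      exact hw.2
    · rintro ⟨u, ⟨⟨hu, hu'⟩, hu''⟩, rfl⟩
      refine ⟨⟨u, hu, rfl⟩, mem_ker_sumOp.2 ⟨hu'', ?_⟩⟩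
      rwa [SetLike.mem_coe, LinearMap.mem_ker, toEuclideanLin_mul_apply] at hu'
  rw [e, h]

theorem rank_fromCols_add_finrank_inf (hD : D.IsHermitian) :
    (fromCols A D).rank + finrank ℂ (LinearMap.ker (toEuclideanLin Aᴴ) ⊓
      LinearMap.ker (toEuclideanLin D) : Submodule ℂ _) = n := by
  have h := rank_add_finrank_ker_conjTranspose (fromCols A D)
  rwa [conjTranspose_fromCols_eq_fromRows_conjTranspose, ker_toEuclideanLin_fromRows, hD.eq,
    Fintype.card_fin] at h

/-- Project `fixedSpace ⊔ ker (D ⊕ M)` to the first coordinate: the image is `ker A* ⊔ ker D` and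
the kernel is the vertical part sought. -/
theorem finrank_vertSpace_inf (hM : M.IsHermitian) (hD : D.IsHermitian) :
    finrank ℂ (vertSpace n m ⊓ (fixedSpace A C ⊔ LinearMap.ker (sumOp M D)) : Submodule ℂ _) +
        finrank ℂ (fixedSpace A C ⊓ LinearMap.ker (sumOp M D) : Submodule ℂ _) =
      finrank ℂ (LinearMap.ker (toEuclideanLin M)) +
        finrank ℂ (LinearMap.ker (toEuclideanLin Aᴴ) ⊓
          LinearMap.ker (toEuclideanLin D) : Submodule ℂ _) := by
  have h1 := finrank_map_add_finrank_inf_ker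
    (fstMap (EuclideanSpace ℂ (Fin n)) (EuclideanSpace ℂ (Fin m)))
    (fixedSpace A C ⊔ LinearMap.ker (sumOp M D))
  have h2 : (fixedSpace A C).map (fstMap (EuclideanSpace ℂ (Fin n)) (EuclideanSpace ℂ (Fin m))) =
      LinearMap.ker (toEuclideanLin Aᴴ) := by
    rw [fixedSpace, ← Submodule.map_comp]
    exact Submodule.map_id _
  have h3 : (LinearMap.ker (sumOp M D)).map
      (fstMap (EuclideanSpace ℂ (Fin n)) (EuclideanSpace ℂ (Fin m))) =
      LinearMap.ker (toEuclideanLin D) := by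
    ext u
    constructor
    · rintro ⟨w, hw, rfl⟩
      exact (mem_ker_sumOp.1 hw).1
    · intro hu
      exact ⟨graphMap 0 u, mem_ker_sumOp.2 ⟨hu, map_zero _⟩, rfl⟩
  rw [Submodule.map_sup, h2, h3, inf_comm] at h1
  have h4 := Submodule.finrank_sup_add_finrank_inf_eq (LinearMap.ker (toEuclideanLin Aᴴ))
    (LinearMap.ker (toEuclideanLin D))
  have h5 := Submodule.finrank_sup_add_finrank_inf_eq (fixedSpace A C) (LinearMap.ker (sumOp M D))
  have h6 := finrank_ker_sumOp hM hD
  have h7 : finrank ℂ (fixedSpace A C) = finrank ℂ (LinearMap.ker (toEuclideanLin Aᴴ)) :=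
    finrank_map_of_injective (graphMap_injective _) _
  rw [vertSpace]
  omega

end Matrices

end QuadInertia

namespace QuadInertia

open Module Submodule
open scoped ComplexOrder

/-! ### The inertia of `N₁` and the rank of `N₂` as subspace data. -/

section Blocks

variable {n p m : ℕ} (A : Matrix (Fin n) (Fin p) ℂ) (C : Matrix (Fin n) (Fin m) ℂ)
  (M : Matrix (Fin m) (Fin m) ℂ) (D : Matrix (Fin n) (Fin n) ℂ)

/-- The projection `(u, z) ↦ u` as a matrix. -/
def projLeft (n p : ℕ) : Matrix (Fin n) (Fin n ⊕ Fin p) ℂ := fromCols 1 0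

/-- The projection `(u, z) ↦ z` as a matrix. -/
def projRight (n p : ℕ) : Matrix (Fin p) (Fin n ⊕ Fin p) ℂ := fromCols 0 1

theorem projLeft_mul_conjTranspose : projLeft n p * (projLeft n p)ᴴ = 1 := by
  simp [projLeft, conjTranspose_fromCols_eq_fromRows_conjTranspose, fromCols_mul_fromRows]

theorem projRight_mul_conjTranspose : projRight n p * (projRight n p)ᴴ = 1 := by
  simp [projRight, conjTranspose_fromCols_eq_fromRows_conjTranspose, fromCols_mul_fromRows]

theorem projLeft_mul_projRight_conjTranspose : projLeft n p * (projRight n p)ᴴ = 0 := by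
  simp [projLeft, projRight, conjTranspose_fromCols_eq_fromRows_conjTranspose,
    fromCols_mul_fromRows]

theorem conjTranspose_mul_add_conjTranspose_mul :
    (projLeft n p)ᴴ * projLeft n p + (projRight n p)ᴴ * projRight n p = 1 := by
  simp only [projLeft, projRight, conjTranspose_fromCols_eq_fromRows_conjTranspose, fromRows_mul,
    mul_fromCols, conjTranspose_one, conjTranspose_zero, Matrix.one_mul, Matrix.zero_mul]
  ext (i | i) (j | j) <;> simp [Matrix.one_apply]

theorem N₁_eq : N₁ A C M D =
    (projLeft n p)ᴴ * (C * M * Cᴴ + D) * projLeft n p + (projLeft n p)ᴴ * A * projRight n p +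
      (projRight n p)ᴴ * Aᴴ * projLeft n p := by
  simp only [projLeft, projRight, conjTranspose_fromCols_eq_fromRows_conjTranspose, fromRows_mul,
    mul_fromCols, conjTranspose_one, conjTranspose_zero, Matrix.one_mul, Matrix.zero_mul,
    Matrix.mul_one, Matrix.mul_zero, N₁]
  ext (i | i) (j | j) <;> simp [add_comm]

variable {M D}

theorem isHermitian_N₁ (hM : M.IsHermitian) (hD : D.IsHermitian) : (N₁ A C M D).IsHermitian :=
  IsHermitian.fromBlocks (by rw [add_comm]; exact isHermitian_mul_mul_add hM hD C) rfl
    (Matrix.isHermitian_zero)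

theorem mul_projRight_conjTranspose :
    N₁ A C M D * (projRight n p)ᴴ = (projLeft n p)ᴴ * A := by
  rw [N₁_eq]
  simp only [Matrix.add_mul, Matrix.mul_assoc, projLeft_mul_projRight_conjTranspose,
    projRight_mul_conjTranspose, Matrix.mul_zero, Matrix.mul_one, zero_add, add_zero]

theorem projRight_conjTranspose_injective :
    Function.Injective (toEuclideanLin (projRight n p)ᴴ) := by
  intro x y h
  have h1 := congrArg (toEuclideanLin (projRight n p)) h
  rwa [← toEuclideanLin_mul_apply, ← toEuclideanLin_mul_apply, projRight_mul_conjTranspose,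
    toLpLin_one, LinearMap.id_apply, LinearMap.id_apply] at h1

theorem map_projLeft (S : Submodule ℂ (EuclideanSpace ℂ (Fin n))) :
    (S.comap (toEuclideanLin (projLeft n p))).map (toEuclideanLin (projLeft n p)) = S := by
  apply Submodule.map_comap_eq_of_surjective
  intro u
  refine ⟨toEuclideanLin (projLeft n p)ᴴ u, ?_⟩
  rw [← toEuclideanLin_mul_apply, projLeft_mul_conjTranspose, toLpLin_one, LinearMap.id_apply]

/-- Let `K = {(u, z) : A* u = 0}`. There the form of `T₁` is that of `T` on `fixedSpace`, and the
vectors `(0, z)` lie in the radical of `K`. Coupling to the rest of the space through `A`, they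
raise the index by at least `r(A)`, while the codimension of `K` allows no more. The hypotheses suit
both `N₁` and `-N₁`. -/
theorem idx_block (T₁ : EuclideanSpace ℂ (Fin n ⊕ Fin p) →ₗ[ℂ] EuclideanSpace ℂ (Fin n ⊕ Fin p))
    (hT₁ : T₁.IsSymmetric)
    (T : WithLp 2 (EuclideanSpace ℂ (Fin n) × EuclideanSpace ℂ (Fin m)) →ₗ[ℂ]
      WithLp 2 (EuclideanSpace ℂ (Fin n) × EuclideanSpace ℂ (Fin m)))
    (hq : ∀ x ∈ LinearMap.ker (toEuclideanLin (Aᴴ * projLeft n p)),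
      quad T₁ x = quad T (graphMap (toEuclideanLin Cᴴ) (toEuclideanLin (projLeft n p) x)))
    (hA : ∀ z, ‖T₁ (toEuclideanLin (projRight n p)ᴴ z)‖ =
      ‖toEuclideanLin ((projLeft n p)ᴴ * A) z‖)
    (hZ : LinearMap.range (toEuclideanLin (projRight n p)ᴴ) ≤
      orth T₁ (LinearMap.ker (toEuclideanLin (Aᴴ * projLeft n p)))) :
    idx T₁ ⊤ = A.rank + idx T (fixedSpace A C) := by
  set K := LinearMap.ker (toEuclideanLin (Aᴴ * projLeft n p)) with hK
  have hKcomap : K = (LinearMap.ker (toEuclideanLin Aᴴ)).comap (toEuclideanLin (projLeft n p)) := by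
    ext x
    rw [hK, LinearMap.mem_ker, toEuclideanLin_mul_apply, Submodule.mem_comap, LinearMap.mem_ker]
  have h1 : idx T₁ K = idx T (fixedSpace A C) := by
    rw [idx_map (T := T) (graphMap (toEuclideanLin Cᴴ) ∘ₗ toEuclideanLin (projLeft n p)) hq,
      Submodule.map_comp, hKcomap, map_projLeft, fixedSpace]
  have hZK : LinearMap.range (toEuclideanLin (projRight n p)ᴴ) ≤ K := by
    rintro _ ⟨z, rfl⟩
    rw [hK, LinearMap.mem_ker, ← toEuclideanLin_mul_apply, Matrix.mul_assoc,
      projLeft_mul_projRight_conjTranspose, Matrix.mul_zero, map_zero, LinearMap.zero_apply]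
  have h2 := idx_add_finrank_le_idx hT₁ (le_top : K ≤ ⊤) hZK hZ
  have h3 : LinearMap.range (toEuclideanLin (projRight n p)ᴴ) ⊓ orth T₁ ⊤ ≤
      (LinearMap.ker (toEuclideanLin A)).map (toEuclideanLin (projRight n p)ᴴ) := by
    rintro _ ⟨⟨z, rfl⟩, hz⟩
    refine ⟨z, ?_, rfl⟩
    rw [orth_top hT₁, SetLike.mem_coe, LinearMap.mem_ker, ← norm_eq_zero, hA, norm_eq_zero] at hz
    have h4 := congrArg (toEuclideanLin (projLeft n p)) hz
    rw [← toEuclideanLin_mul_apply, ← Matrix.mul_assoc, projLeft_mul_conjTranspose,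
      Matrix.one_mul, map_zero] at h4
    exact h4
  have h4 := Submodule.finrank_mono h3
  rw [finrank_map_of_injective projRight_conjTranspose_injective] at h4
  rw [LinearMap.finrank_range_of_inj projRight_conjTranspose_injective,
    finrank_euclideanSpace_fin] at h2
  have h5 := finrank_ker_toEuclideanLin A
  have h6 := idx_add_finrank_le T₁ (le_top : K ≤ ⊤)
  have h7 := finrank_ker_toEuclideanLin (Aᴴ * projLeft n p)
  have h8 := rank_mul_le_left Aᴴ (projLeft n p)
  rw [rank_conjTranspose] at h8
  rw [← hK] at h7
  rw [finrank_top, finrank_euclideanSpace] at h6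
  rw [Fintype.card_fin] at h5
  omega

theorem quad_N₁ {x : EuclideanSpace ℂ (Fin n ⊕ Fin p)}
    (hx : x ∈ LinearMap.ker (toEuclideanLin (Aᴴ * projLeft n p))) :
    quad (toEuclideanLin (N₁ A C M D)) x =
      quad (sumOp M D) (graphMap (toEuclideanLin Cᴴ) (toEuclideanLin (projLeft n p) x)) := by
  rw [LinearMap.mem_ker, toEuclideanLin_mul_apply] at hx
  rw [← quad_mul_mul_add, N₁_eq]
  simp only [quad, map_add, LinearMap.add_apply, inner_add_left, Complex.add_re, Matrix.mul_assoc,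
    toEuclideanLin_mul_apply, inner_toEuclideanLin_left (projLeft n p)ᴴ, hx, map_zero,
    inner_zero_left, conjTranspose_conjTranspose]
  rw [inner_toEuclideanLin_left A, hx, inner_zero_right]
  simp

theorem range_le_orth_N₁ (hM : M.IsHermitian) (hD : D.IsHermitian) :
    LinearMap.range (toEuclideanLin (projRight n p)ᴴ) ≤
      orth (toEuclideanLin (N₁ A C M D)) (LinearMap.ker (toEuclideanLin (Aᴴ * projLeft n p))) := by
  rintro _ ⟨z, rfl⟩
  rw [mem_orth' (isSymmetric_toEuclideanLin (isHermitian_N₁ A C hM hD))]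
  intro x hx
  rw [← toEuclideanLin_mul_apply, mul_projRight_conjTranspose, inner_toEuclideanLin_left,
    conjTranspose_mul, conjTranspose_conjTranspose, LinearMap.mem_ker.1 hx, inner_zero_right]

theorem posInertia_N₁ (hM : M.IsHermitian) (hD : D.IsHermitian) :
    posInertia (N₁ A C M D) = A.rank + idx (sumOp M D) (fixedSpace A C) := by
  have h := isHermitian_N₁ A C hM hD
  rw [posInertia_eq_idx h]
  refine idx_block A C _ (isSymmetric_toEuclideanLin h) _ (fun x hx => quad_N₁ A C hx)
    (fun z => ?_) (range_le_orth_N₁ A C hM hD)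
  rw [← toEuclideanLin_mul_apply, mul_projRight_conjTranspose]

theorem negInertia_N₁ (hM : M.IsHermitian) (hD : D.IsHermitian) :
    negInertia (N₁ A C M D) = A.rank + idx (-sumOp M D) (fixedSpace A C) := by
  have h := isHermitian_N₁ A C hM hD
  rw [negInertia_eq_idx h]
  refine idx_block A C _ (isSymmetric_neg (isSymmetric_toEuclideanLin h)) _
    (fun x hx => by rw [quad_neg, quad_neg, quad_N₁ A C hx])
    (fun z => ?_) (by rw [orth_neg]; exact range_le_orth_N₁ A C hM hD)
  rw [LinearMap.neg_apply, norm_neg, ← toEuclideanLin_mul_apply, mul_projRight_conjTranspose]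

/-- Orthogonality to the vertical space kills `M C* u`; orthogonality to `fixedSpace` then says `D u
⊥ ker A*`. -/
theorem graphMap_mem_orth_iff (hM : M.IsHermitian) (hD : D.IsHermitian)
    {u : EuclideanSpace ℂ (Fin n)} :
    graphMap (toEuclideanLin Cᴴ) u ∈ orth (sumOp M D) (fixedSpace A C ⊔ vertSpace n m) ↔
      toEuclideanLin (M * Cᴴ) u = 0 ∧ toEuclideanLin D u ∈ LinearMap.range (toEuclideanLin A) := by
  rw [orth_sup, Submodule.mem_inf, mem_orth' (isSymmetric_sumOp hM hD),
    mem_orth' (isSymmetric_sumOp hM hD), ← orthogonal_ker_conjTranspose,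
    Submodule.mem_orthogonal', vertSpace, ker_fstMap, toEuclideanLin_mul_apply]
  simp only [sumOp, WithLp.prod_inner_apply]
  constructor
  · rintro ⟨h, h'⟩
    have h1 : toEuclideanLin M (toEuclideanLin Cᴴ u) = 0 := by
      simpa using h' _ ⟨toEuclideanLin M (toEuclideanLin Cᴴ u), rfl⟩
    refine ⟨h1, fun v hv => ?_⟩
    simpa [h1] using h _ ⟨v, hv, rfl⟩
  · rintro ⟨h, h'⟩
    constructor
    · rintro _ ⟨v, hv, rfl⟩
      simp [h, h' v hv]
    · rintro _ ⟨v, rfl⟩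
      simp [h]

theorem ker_N₂_conjTranspose (hM : M.IsHermitian) (hD : D.IsHermitian) :
    LinearMap.ker (toEuclideanLin (N₂ A C M D)ᴴ) =
      LinearMap.ker (toEuclideanLin (D * projLeft n p + A * projRight n p)) ⊓
        LinearMap.ker (toEuclideanLin (M * Cᴴ * projLeft n p)) ⊓
        LinearMap.ker (toEuclideanLin (Aᴴ * projLeft n p)) := by
  have h : (N₂ A C M D)ᴴ = fromRows (fromRows (D * projLeft n p + A * projRight n p)
      (M * Cᴴ * projLeft n p)) (Aᴴ * projLeft n p) := by
    have h1 : Dᴴ = D := hD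
    have h2 : (C * M)ᴴ = M * Cᴴ := by rw [conjTranspose_mul, hM.eq]
    simp only [projLeft, projRight, mul_fromCols, Matrix.mul_one, Matrix.mul_zero,
      fromCols_add_fromCols, zero_add, add_zero]
    rw [← h2]
    conv_rhs => rw [← h1]
    ext ((i | i) | i) (j | j) <;> simp [N₂, -conjTranspose_mul]
  rw [h, ker_toEuclideanLin_fromRows, ker_toEuclideanLin_fromRows]

/-- The kernel of `N₂*` consists of `(u, z)` with `D u + A z = 0`, `M C* u = 0`, `A* u = 0`.
Forgetting `z` maps it onto the stated intersection with fibre `ker A`. -/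
theorem rank_N₂_add_finrank (hM : M.IsHermitian) (hD : D.IsHermitian) :
    (N₂ A C M D).rank + finrank ℂ (fixedSpace A C ⊓
      orth (sumOp M D) (fixedSpace A C ⊔ vertSpace n m) : Submodule ℂ _) = n + A.rank := by
  have h := rank_add_finrank_ker_conjTranspose (N₂ A C M D)
  rw [Fintype.card_sum, Fintype.card_fin, Fintype.card_fin, ker_N₂_conjTranspose A C hM hD] at h
  set X := LinearMap.ker (toEuclideanLin (D * projLeft n p + A * projRight n p)) ⊓
        LinearMap.ker (toEuclideanLin (M * Cᴴ * projLeft n p)) ⊓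
        LinearMap.ker (toEuclideanLin (Aᴴ * projLeft n p)) with hX
  have hmem : ∀ x, x ∈ X ↔ (toEuclideanLin D (toEuclideanLin (projLeft n p) x) +
      toEuclideanLin A (toEuclideanLin (projRight n p) x) = 0 ∧
      toEuclideanLin (M * Cᴴ) (toEuclideanLin (projLeft n p) x) = 0) ∧
      toEuclideanLin Aᴴ (toEuclideanLin (projLeft n p) x) = 0 := by
    intro x
    simp only [hX, Submodule.mem_inf, LinearMap.mem_ker, map_add, LinearMap.add_apply,
      toEuclideanLin_mul_apply]
  have hdec : ∀ x, toEuclideanLin (projLeft n p)ᴴ (toEuclideanLin (projLeft n p) x) +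
      toEuclideanLin (projRight n p)ᴴ (toEuclideanLin (projRight n p) x) = x := by
    intro x
    rw [← toEuclideanLin_mul_apply, ← toEuclideanLin_mul_apply, ← LinearMap.add_apply, ← map_add,
      conjTranspose_mul_add_conjTranspose_mul, toLpLin_one, LinearMap.id_apply]
  have hLL : ∀ u, toEuclideanLin (projLeft n p) (toEuclideanLin (projLeft n p)ᴴ u) = u := by
    intro u
    rw [← toEuclideanLin_mul_apply, projLeft_mul_conjTranspose, toLpLin_one, LinearMap.id_apply]
  have hRR : ∀ u, toEuclideanLin (projRight n p) (toEuclideanLin (projRight n p)ᴴ u) = u := by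
    intro u
    rw [← toEuclideanLin_mul_apply, projRight_mul_conjTranspose, toLpLin_one, LinearMap.id_apply]
  have hLR : ∀ u, toEuclideanLin (projLeft n p) (toEuclideanLin (projRight n p)ᴴ u) = 0 := by
    intro u
    rw [← toEuclideanLin_mul_apply, projLeft_mul_projRight_conjTranspose, map_zero,
      LinearMap.zero_apply]
  have hRL : ∀ u, toEuclideanLin (projRight n p) (toEuclideanLin (projLeft n p)ᴴ u) = 0 := by
    intro u
    have h1 := congrArg conjTranspose (projLeft_mul_projRight_conjTranspose (n := n) (p := p))
    rw [conjTranspose_mul, conjTranspose_conjTranspose, conjTranspose_zero] at h1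
    rw [← toEuclideanLin_mul_apply, h1, map_zero, LinearMap.zero_apply]
  have hrn := finrank_map_add_finrank_inf_ker
    (graphMap (toEuclideanLin Cᴴ) ∘ₗ toEuclideanLin (projLeft n p)) X
  have hmap : X.map (graphMap (toEuclideanLin Cᴴ) ∘ₗ toEuclideanLin (projLeft n p)) =
      fixedSpace A C ⊓ orth (sumOp M D) (fixedSpace A C ⊔ vertSpace n m) := by
    ext w
    constructor
    · rintro ⟨x, hx, rfl⟩
      obtain ⟨⟨h1, h2⟩, h3⟩ := (hmem x).1 hx
      refine ⟨⟨_, h3, rfl⟩, (graphMap_mem_orth_iff A C hM hD).2 ⟨h2, ?_⟩⟩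
      rw [add_eq_zero_iff_eq_neg, ← map_neg] at h1
      exact ⟨_, h1.symm⟩
    · rintro ⟨⟨u, hu, rfl⟩, hw⟩
      obtain ⟨h1, z, hz⟩ := (graphMap_mem_orth_iff A C hM hD).1 hw
      refine ⟨toEuclideanLin (projLeft n p)ᴴ u - toEuclideanLin (projRight n p)ᴴ z,
        (hmem _).2 ?_, ?_⟩
      · simp only [map_sub, hLL, hRR, hLR, hRL, sub_zero, zero_sub, map_neg, hz]
        exact ⟨⟨add_neg_cancel _, h1⟩, hu⟩
      · rw [LinearMap.comp_apply, map_sub, hLL, hLR, sub_zero]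
  have hker : X ⊓ LinearMap.ker (graphMap (toEuclideanLin Cᴴ) ∘ₗ toEuclideanLin (projLeft n p)) =
      (LinearMap.ker (toEuclideanLin A)).map (toEuclideanLin (projRight n p)ᴴ) := by
    ext x
    constructor
    · rintro ⟨hx, hx0⟩
      have h0 : toEuclideanLin (projLeft n p) x = 0 := congrArg (fun w => w.fst) hx0
      have h1 := ((hmem x).1 hx).1.1
      rw [h0, map_zero, zero_add] at h1
      refine ⟨_, h1, ?_⟩
      have h2 := hdec x
      rwa [h0, map_zero, zero_add] at h2
    · rintro ⟨z, hz, rfl⟩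
      refine ⟨(hmem _).2 ?_, ?_⟩
      · rw [hLR, hRR, map_zero, map_zero, map_zero, zero_add]
        exact ⟨⟨hz, rfl⟩, rfl⟩
      · rw [SetLike.mem_coe, LinearMap.mem_ker, LinearMap.comp_apply, hLR, map_zero]
  rw [hmap, hker, finrank_map_of_injective projRight_conjTranspose_injective] at hrn
  have h5 := finrank_ker_toEuclideanLin A
  rw [Fintype.card_fin] at h5
  omega

theorem rank_phi_le (X : Matrix (Fin p) (Fin m) ℂ) :
    (phi A C M D X).rank ≤ (fromCols (fromCols A (C * M)) D).rank := by
  have h : phi A C M D X = fromCols (fromCols A (C * M)) D *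
      (fromRows (fromRows (X * M * (A * X + C)ᴴ) (A * X + C)ᴴ) 1 :
        Matrix ((Fin p ⊕ Fin m) ⊕ Fin n) (Fin n) ℂ) := by
    rw [fromCols_mul_fromRows, fromCols_mul_fromRows, phi]
    simp only [Matrix.add_mul, Matrix.mul_assoc, Matrix.mul_one]
  rw [h]
  exact rank_mul_le_left _ _

end Blocks

end QuadInertia

namespace QuadInertia

open Module Submodule

/-! ### The bounds on inertias and their attainment, in matrix terms. -/

section Bounds

variable {n p m : ℕ} (A : Matrix (Fin n) (Fin p) ℂ) (C : Matrix (Fin n) (Fin m) ℂ)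
  {M : Matrix (Fin m) (Fin m) ℂ} {D : Matrix (Fin n) (Fin n) ℂ}

theorem isHermitian_phi (hM : M.IsHermitian) (hD : D.IsHermitian) (X : Matrix (Fin p) (Fin m) ℂ) :
    (phi A C M D X).IsHermitian := isHermitian_mul_mul_add hM hD _

theorem posInertia_phi_le (hM : M.IsHermitian) (hD : D.IsHermitian)
    (X : Matrix (Fin p) (Fin m) ℂ) :
    posInertia (phi A C M D X) ≤ min (posInertia (N₁ A C M D)) (posInertia M + posInertia D) := by
  have h1 := idx_add_finrank_le (sumOp M D) (fixedSpace_le_graphSpace A C X)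
  have h2 := idx_mono (sumOp M D) (le_top : graphSpace A C X ≤ ⊤)
  have h3 := finrank_fixedSpace A C
  rw [finrank_graphSpace] at h1
  rw [idx_sumOp_top hM hD] at h2
  rw [posInertia_phi A C hM hD, posInertia_N₁ A C hM hD]
  omega

theorem negInertia_phi_le (hM : M.IsHermitian) (hD : D.IsHermitian)
    (X : Matrix (Fin p) (Fin m) ℂ) :
    negInertia (phi A C M D X) ≤ min (negInertia (N₁ A C M D)) (negInertia M + negInertia D) := by
  have h1 := idx_add_finrank_le (-sumOp M D) (fixedSpace_le_graphSpace A C X)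
  have h2 := idx_mono (-sumOp M D) (le_top : graphSpace A C X ≤ ⊤)
  have h3 := finrank_fixedSpace A C
  rw [finrank_graphSpace] at h1
  rw [idx_neg_sumOp_top hM hD] at h2
  rw [negInertia_phi A C hM hD, negInertia_N₁ A C hM hD]
  omega

theorem exists_posInertia_phi_ge (hM : M.IsHermitian) (hD : D.IsHermitian) :
    ∃ X, min (posInertia (N₁ A C M D)) (posInertia M + posInertia D) ≤
      posInertia (phi A C M D X) := by
  obtain ⟨V, hFV, hV, h⟩ :=
    exists_isCompl_idx_ge (isSymmetric_sumOp hM hD) (disjoint_fixedSpace A C)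
  obtain ⟨X, rfl⟩ := exists_graphSpace_eq A C hFV hV
  refine ⟨X, ?_⟩
  have h3 := finrank_fixedSpace A C
  rw [finrank_withLp, finrank_vertSpace, idx_sumOp_top hM hD] at h
  rw [posInertia_phi A C hM hD, posInertia_N₁ A C hM hD]
  omega

theorem exists_negInertia_phi_ge (hM : M.IsHermitian) (hD : D.IsHermitian) :
    ∃ X, min (negInertia (N₁ A C M D)) (negInertia M + negInertia D) ≤
      negInertia (phi A C M D X) := by
  obtain ⟨V, hFV, hV, h⟩ :=
    exists_isCompl_idx_ge (isSymmetric_neg (isSymmetric_sumOp hM hD)) (disjoint_fixedSpace A C)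
  obtain ⟨X, rfl⟩ := exists_graphSpace_eq A C hFV hV
  refine ⟨X, ?_⟩
  have h3 := finrank_fixedSpace A C
  rw [finrank_withLp, finrank_vertSpace, idx_neg_sumOp_top hM hD] at h
  rw [negInertia_phi A C hM hD, negInertia_N₁ A C hM hD]
  omega

/-- Evaluates the correction term in `idx_lower_bound_left`; `rank_sub_rank_fromCols_eq` does the
same for `idx_lower_bound_right`. -/
theorem rank_sub_rank_N₂_eq (hM : M.IsHermitian) (hD : D.IsHermitian) :
    ((fromCols (fromCols A (C * M)) D).rank : ℤ) - (N₂ A C M D).rank + A.rank =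
      finrank ℂ (fixedSpace A C ⊓
        orth (sumOp M D) (fixedSpace A C ⊔ vertSpace n m) : Submodule ℂ _) -
      finrank ℂ (fixedSpace A C ⊓ LinearMap.ker (sumOp M D) : Submodule ℂ _) := by
  have h1 := rank_fromCols_add_finrank A C hM hD
  have h2 := rank_N₂_add_finrank A C hM hD
  omega

theorem rank_sub_rank_fromCols_eq (hM : M.IsHermitian) (hD : D.IsHermitian) :
    ((fromCols (fromCols A (C * M)) D).rank : ℤ) - (fromCols A D).rank + m - M.rank =
      finrank ℂ (vertSpace n m ⊓ (fixedSpace A C ⊔ LinearMap.ker (sumOp M D)) :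
        Submodule ℂ _) := by
  have h1 := rank_fromCols_add_finrank A C hM hD
  have h2 := rank_fromCols_add_finrank_inf A hD
  have h3 := finrank_vertSpace_inf A C hM hD
  have h4 := finrank_ker_toEuclideanLin M
  rw [Fintype.card_fin] at h4
  omega

theorem le_posInertia_phi (hM : M.IsHermitian) (hD : D.IsHermitian)
    (X : Matrix (Fin p) (Fin m) ℂ) :
    ((fromCols (fromCols A (C * M)) D).rank : ℤ) +
      max ((posInertia (N₁ A C M D) : ℤ) - (N₂ A C M D).rank)
        ((posInertia D : ℤ) - (fromCols A D).rank - negInertia M) ≤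
      posInertia (phi A C M D X) := by
  have h1 := idx_lower_bound_left (isSymmetric_sumOp hM hD) (fixedSpace_le_graphSpace A C X)
    (isCompl_graphSpace A C X).sup_eq_top
  have h2 := idx_lower_bound_right (isSymmetric_sumOp hM hD) (fixedSpace_le_graphSpace A C X)
    (isCompl_graphSpace A C X).sup_eq_top
  have h3 := rank_sub_rank_N₂_eq A C hM hD
  have h4 := rank_sub_rank_fromCols_eq A C hM hD
  rw [finrank_vertSpace, idx_sumOp_top hM hD] at h2
  rw [rank_eq_posInertia_add_negInertia hM] at h4
  rw [posInertia_phi A C hM hD, posInertia_N₁ A C hM hD]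
  omega

theorem le_negInertia_phi (hM : M.IsHermitian) (hD : D.IsHermitian)
    (X : Matrix (Fin p) (Fin m) ℂ) :
    ((fromCols (fromCols A (C * M)) D).rank : ℤ) +
      max ((negInertia (N₁ A C M D) : ℤ) - (N₂ A C M D).rank)
        ((negInertia D : ℤ) - (fromCols A D).rank - posInertia M) ≤
      negInertia (phi A C M D X) := by
  have h1 := idx_lower_bound_left (isSymmetric_neg (isSymmetric_sumOp hM hD))
    (fixedSpace_le_graphSpace A C X) (isCompl_graphSpace A C X).sup_eq_top
  have h2 := idx_lower_bound_right (isSymmetric_neg (isSymmetric_sumOp hM hD))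
    (fixedSpace_le_graphSpace A C X) (isCompl_graphSpace A C X).sup_eq_top
  have h3 := rank_sub_rank_N₂_eq A C hM hD
  have h4 := rank_sub_rank_fromCols_eq A C hM hD
  rw [orth_neg, ker_neg] at h1
  rw [ker_neg, finrank_vertSpace, idx_neg_sumOp_top hM hD] at h2
  rw [rank_eq_posInertia_add_negInertia hM] at h4
  rw [negInertia_phi A C hM hD, negInertia_N₁ A C hM hD]
  omega

/-- Both inertias of `φ(X)` are minimized by the same `X`. -/
theorem exists_inertia_phi_eq (hM : M.IsHermitian) (hD : D.IsHermitian) :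
    ∃ X, (posInertia (phi A C M D X) : ℤ) = (fromCols (fromCols A (C * M)) D).rank +
        max ((posInertia (N₁ A C M D) : ℤ) - (N₂ A C M D).rank)
          ((posInertia D : ℤ) - (fromCols A D).rank - negInertia M) ∧
      (negInertia (phi A C M D X) : ℤ) = (fromCols (fromCols A (C * M)) D).rank +
        max ((negInertia (N₁ A C M D) : ℤ) - (N₂ A C M D).rank)
          ((negInertia D : ℤ) - (fromCols A D).rank - posInertia M) := by
  obtain ⟨V, hFV, hV, hp, hn⟩ :=
    exists_isCompl_idx_le (isSymmetric_sumOp hM hD) (disjoint_fixedSpace A C)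
  obtain ⟨X, rfl⟩ := exists_graphSpace_eq A C hFV hV
  have h3 := rank_sub_rank_N₂_eq A C hM hD
  have h4 := rank_sub_rank_fromCols_eq A C hM hD
  rw [rank_eq_posInertia_add_negInertia hM] at h4
  refine ⟨X, le_antisymm ?_ (le_posInertia_phi A C hM hD X),
    le_antisymm ?_ (le_negInertia_phi A C hM hD X)⟩
  · rw [finrank_vertSpace, idx_sumOp_top hM hD] at hp
    rw [posInertia_phi A C hM hD, posInertia_N₁ A C hM hD]
    clear hn
    omega
  · rw [finrank_vertSpace, idx_neg_sumOp_top hM hD] at hn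
    rw [negInertia_phi A C hM hD, negInertia_N₁ A C hM hD]
    clear hp
    omega

end Bounds

end QuadInertia

/-! ### Assembly of the six extremal values. -/

open QuadInertia in
theorem mainTheorem11 (n p m : ℕ)
    (A : Matrix (Fin n) (Fin p) ℂ) (C : Matrix (Fin n) (Fin m) ℂ)
    (D : Matrix (Fin n) (Fin n) ℂ) (hD : D.IsHermitian)
    (M : Matrix (Fin m) (Fin m) ℂ) (hM : M.IsHermitian)
    (N₁ : Matrix (Fin n ⊕ Fin p) (Fin n ⊕ Fin p) ℂ) (hN₁ : N₁ = QuadInertia.N₁ A C M D)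
    (N₂ : Matrix (Fin n ⊕ Fin p) ((Fin n ⊕ Fin m) ⊕ Fin p) ℂ)
    (hN₂ : N₂ = QuadInertia.N₂ A C M D)
    (ρ : ℕ) (hρ : ρ = (fromCols (fromCols A (C * M)) D).rank)
    (δ : ℕ) (hδ : δ = (fromCols A D).rank)
    (s₁ s₂ s₃ s₄ : ℤ)
    (hs₁ : s₁ = (N₁.rank : ℤ) - 2 * N₂.rank)
    (hs₂ : s₂ = (D.rank : ℤ) - 2 * δ - M.rank)
    (hs₃ : s₃ = (QuadInertia.posInertia N₁ : ℤ) - N₂.rank + QuadInertia.negInertia D - δ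
      - QuadInertia.posInertia M)
    (hs₄ : s₄ = (QuadInertia.negInertia N₁ : ℤ) - N₂.rank + QuadInertia.posInertia D - δ
      - QuadInertia.negInertia M) :
    -- maximal rank
    IsGreatest (Set.range fun X : Matrix (Fin p) (Fin m) ℂ =>
        (QuadInertia.phi A C M D X).rank)
      (min ρ (min N₁.rank (M.rank + D.rank))) ∧
    -- minimal rank
    IsLeast (Set.range fun X : Matrix (Fin p) (Fin m) ℂ =>
        ((QuadInertia.phi A C M D X).rank : ℤ))
      (2 * ρ + max (max s₁ s₂) (max s₃ s₄)) ∧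
    -- maximal partial inertias
    IsGreatest (Set.range fun X : Matrix (Fin p) (Fin m) ℂ =>
        QuadInertia.posInertia (QuadInertia.phi A C M D X))
      (min (QuadInertia.posInertia N₁)
        (QuadInertia.posInertia M + QuadInertia.posInertia D)) ∧
    IsGreatest (Set.range fun X : Matrix (Fin p) (Fin m) ℂ =>
        QuadInertia.negInertia (QuadInertia.phi A C M D X))
      (min (QuadInertia.negInertia N₁)
        (QuadInertia.negInertia M + QuadInertia.negInertia D)) ∧
    -- minimal partial inertias
    IsLeast (Set.range fun X : Matrix (Fin p) (Fin m) ℂ =>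
        (QuadInertia.posInertia (QuadInertia.phi A C M D X) : ℤ))
      (ρ + max ((QuadInertia.posInertia N₁ : ℤ) - N₂.rank)
        ((QuadInertia.posInertia D : ℤ) - δ - QuadInertia.negInertia M)) ∧
    IsLeast (Set.range fun X : Matrix (Fin p) (Fin m) ℂ =>
        (QuadInertia.negInertia (QuadInertia.phi A C M D X) : ℤ))
      (ρ + max ((QuadInertia.negInertia N₁ : ℤ) - N₂.rank)
        ((QuadInertia.negInertia D : ℤ) - δ - QuadInertia.posInertia M)) := by
  subst hN₁ hN₂ hρ hδ hs₁ hs₂ hs₃ hs₄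
  have hφ : ∀ X, ((phi A C M D X).rank : ℤ) =
      posInertia (phi A C M D X) + negInertia (phi A C M D X) := fun X => by
    exact_mod_cast rank_eq_posInertia_add_negInertia (isHermitian_phi A C hM hD X)
  have rN := rank_eq_posInertia_add_negInertia (isHermitian_N₁ A C hM hD)
  have rM := rank_eq_posInertia_add_negInertia hM
  have rD := rank_eq_posInertia_add_negInertia hD
  have rankle : ∀ X, (phi A C M D X).rank ≤ min (fromCols (fromCols A (C * M)) D).rank
      (min (QuadInertia.N₁ A C M D).rank (M.rank + D.rank)) := by
    intro X
    have h1 := posInertia_phi_le A C hM hD X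
    have h2 := negInertia_phi_le A C hM hD X
    have h3 := hφ X
    rw [le_min_iff] at h1 h2
    refine le_min (rank_phi_le A C X) (le_min ?_ ?_) <;> omega
  -- The sum of two maxima of two terms is the maximum of the four sums, which are `s₁, …, s₄`.
  have hsum : ∀ a b c d ρ r δ i j k l : ℤ, a = ρ + max (i - r) (k - δ - c) →
      b = ρ + max (j - r) (l - δ - d) → a + b = 2 * ρ +
        max (max (i + j - 2 * r) (k + l - 2 * δ - (d + c)))
          (max (i - r + l - δ - d) (j - r + k - δ - c)) := by
    intros; omega
  -- As `X₀` minimizes both inertias at once, the minimal rank is the sum of their minima.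
  obtain ⟨X₀, hp, hn⟩ := exists_inertia_phi_eq A C hM hD
  have hr : (((phi A C M D X₀).rank : ℕ) : ℤ) = 2 * (fromCols (fromCols A (C * M)) D).rank +
      max (max (((QuadInertia.N₁ A C M D).rank : ℤ) - 2 * (QuadInertia.N₂ A C M D).rank)
        ((D.rank : ℤ) - 2 * (fromCols A D).rank - M.rank))
      (max ((posInertia (QuadInertia.N₁ A C M D) : ℤ) - (QuadInertia.N₂ A C M D).rank +
          negInertia D - (fromCols A D).rank - posInertia M)
        ((negInertia (QuadInertia.N₁ A C M D) : ℤ) - (QuadInertia.N₂ A C M D).rank +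
          posInertia D - (fromCols A D).rank - negInertia M)) := by
    rw [hφ, hsum _ _ _ _ _ _ _ _ _ _ _ hp hn, rN, rM, rD]
    push_cast
    rfl
  refine ⟨⟨?_, ?_⟩, ⟨⟨X₀, hr⟩, ?_⟩, ⟨?_, ?_⟩, ⟨?_, ?_⟩, ⟨⟨X₀, hp⟩, ?_⟩, ⟨⟨X₀, hn⟩, ?_⟩⟩
  · obtain ⟨X, hX⟩ := exists_rank_phi_ge A C hM hD
    exact ⟨X, le_antisymm (rankle X) hX⟩
  · rintro _ ⟨X, rfl⟩
    exact rankle X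
  · rintro _ ⟨X, rfl⟩
    rw [← hr]
    dsimp only
    rw [hφ, hφ, hp, hn]
    exact add_le_add (le_posInertia_phi A C hM hD X) (le_negInertia_phi A C hM hD X)
  · obtain ⟨X, hX⟩ := exists_posInertia_phi_ge A C hM hD
    exact ⟨X, le_antisymm (posInertia_phi_le A C hM hD X) hX⟩
  · rintro _ ⟨X, rfl⟩
    exact posInertia_phi_le A C hM hD X
  · obtain ⟨X, hX⟩ := exists_negInertia_phi_ge A C hM hD
    exact ⟨X, le_antisymm (negInertia_phi_le A C hM hD X) hX⟩
  · rintro _ ⟨X, rfl⟩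
    exact negInertia_phi_le A C hM hD X
  · rintro _ ⟨X, rfl⟩
    exact le_posInertia_phi A C hM hD X
  · rintro _ ⟨X, rfl⟩
    exact le_negInertia_phi A C hM hD X
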